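/- Let $s\in(0,1)$ and $0<\lambda\le\Lambda$, and let $K:\mathbb{R}^2\setminus\{0\}\to\mathbb{R}$ be a kernel of class $\mathcal L_2(s,\lambda,\Lambda)$, that is, $K(z)=K(-z)$, $$\frac{\lambda}{|z|^{2+s}}\le K(z)\le\frac{\Lambda}{|z|^{2+s}}\qquad\text{and}\qquad \max\bigl\{|z|\,|\partial_eK(z)|,\ |z|^2|\partial_{ee}K(z)|\bigr\}\le\frac{\Lambda}{|z|^{2+s}}$$ for all $z\ne0$ and all unit vectors $e$ (these directional derivatives being assumed to exist). For $\Omega\subset\mathbb{R}^2$ and measurable $E\subset\mathbb{R}^2$, with complement $E^c$, put $L_K(A,B)=\int_A\int_BK(x-y)\,dy\,dx$ and $$P_{K,\Omega}(E)=L_K(E\cap\Omega,E^c\cap\Omega)+L_K(E\cap\Omega,E^c\setminus\Omega)+L_K(E\setminus\Omega,E^c\cap\Omega)\in[0,\infty].$$ The set $E$ is called stable for $P_{K,\Omega}$ if $P_{K,\Omega}(E)<\infty$ and, for every vector field $X=X(x,t)\in C^2_c(\Omega\times(-1,1);\mathbb{R}^2)$ with integral flow $\Psi_t$ (so $\Psi_0=\mathrm{id}$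 and $\partial_t\Psi_t(x)=X(\Psi_t(x),t)$) and every $\varepsilon>0$, there is $t_0>0$ such that, for all $t\in(-t_0,t_0)$, with $F_t=\Psi_t(E)$, $$P_{K,\Omega}(E)\le P_{K,\Omega}(F_t\cup E)+\varepsilon t^2\qquad\text{and}\qquad P_{K,\Omega}(E)\le P_{K,\Omega}(F_t\cap E)+\varepsilon t^2 .$$ The set $E$ is called stable in every compact set of $\mathbb{R}^2$ if it is stable for $P_{K,\Omega}$ for every bounded open set $\Omega\subset\mathbb{R}^2$. Then, apart from the trivial sets, half-planes are the only sets that are stable in every compact set of $\mathbb{R}^2$. Precisely, a (Lebesgue) measurable set $E\subset\mathbb{R}^2$ is stable in every compact set of $\mathbb{R}^2$ if and only if, up to a set of measure zero, $E$ is $\emptyset$, or $\mathbb{R}^2$, or a half-plane $\{x:\ \nu\cdot x\le c\}$ with $|\nu|=1$ and $c\in\mathbb{R}$. -/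

import Mathlib

open MeasureTheory Set

/-- The class `𝓛₂(s, lam, Lam)` of interaction kernels on `ℝⁿ`: even kernels that are comparable
to `|z|^{-(n+s)}` and whose directional derivatives `∂ₑK`, `∂ₑₑK` exist away from the origin and
satisfy `max (|z| |∂ₑK(z)|) (|z|² |∂ₑₑK(z)|) ≤ Lam / |z|^{n+s}` for every unit vector `e`.
The value of `K` at the origin plays no role. -/
structure IsL2Kernel (n : ℕ) (s lam Lam : ℝ) (K : EuclideanSpace ℝ (Fin n) → ℝ) : Prop where
  even : ∀ z, K z = K (-z)
  lower : ∀ z, z ≠ 0 → lam / ‖z‖ ^ ((n : ℝ) + s) ≤ K z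
  upper : ∀ z, z ≠ 0 → K z ≤ Lam / ‖z‖ ^ ((n : ℝ) + s)
  differentiable : ∀ z, z ≠ 0 → ∀ e, ‖e‖ = 1 → LineDifferentiableAt ℝ K z e
  differentiable_two : ∀ z, z ≠ 0 → ∀ e, ‖e‖ = 1 →
    LineDifferentiableAt ℝ (fun y => lineDeriv ℝ K y e) z e
  deriv_bound : ∀ z, z ≠ 0 → ∀ e, ‖e‖ = 1 →
    max (‖z‖ * |lineDeriv ℝ K z e|)
        (‖z‖ ^ 2 * |lineDeriv ℝ (fun y => lineDeriv ℝ K y e) z e|)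
      ≤ Lam / ‖z‖ ^ ((n : ℝ) + s)

/-- The interaction `L_K(A, B) = ∫_A ∫_B K(x - y) dy dx`, with values in `[0, ∞]`. -/
noncomputable def kInteraction {n : ℕ} (K : EuclideanSpace ℝ (Fin n) → ℝ)
    (A B : Set (EuclideanSpace ℝ (Fin n))) : ENNReal :=
  ∫⁻ x in A, ∫⁻ y in B, ENNReal.ofReal (K (x - y))

/-- The `K`-perimeter `P_{K,Ω}(E)` of `E` inside `Ω`. -/
noncomputable def kPerimeter {n : ℕ} (K : EuclideanSpace ℝ (Fin n) → ℝ)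
    (Ω E : Set (EuclideanSpace ℝ (Fin n))) : ENNReal :=
  kInteraction K (E ∩ Ω) (Eᶜ ∩ Ω) + kInteraction K (E ∩ Ω) (Eᶜ \ Ω)
    + kInteraction K (E \ Ω) (Eᶜ ∩ Ω)

/-- `X ∈ C²_c(Ω × (-1, 1); ℝⁿ)`, extended by zero to `ℝⁿ × ℝ`. -/
def IsTestField {n : ℕ} (Ω : Set (EuclideanSpace ℝ (Fin n)))
    (X : EuclideanSpace ℝ (Fin n) × ℝ → EuclideanSpace ℝ (Fin n)) : Prop :=
  ContDiff ℝ 2 X ∧ HasCompactSupport X ∧ tsupport X ⊆ Ω ×ˢ Ioo (-1 : ℝ) 1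

/-- `Ψ` is the integral flow of the time-dependent field `X`:
`Ψ₀ = id` and `∂ₜ Ψₜ(x) = X(Ψₜ(x), t)`. For a test field it exists and is unique. -/
def IsIntegralFlow {n : ℕ} (X : EuclideanSpace ℝ (Fin n) × ℝ → EuclideanSpace ℝ (Fin n))
    (Ψ : ℝ → EuclideanSpace ℝ (Fin n) → EuclideanSpace ℝ (Fin n)) : Prop :=
  ∀ x, Ψ 0 x = x ∧ ∀ t, HasDerivAt (fun τ => Ψ τ x) (X (Ψ t x, t)) t

/-- `E` is a stable set for `P_{K,Ω}`. The inequalities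
`0 ≤ P_{K,Ω}(Fₜ ∪ E) - P_{K,Ω}(E) + ε t²` and `0 ≤ P_{K,Ω}(Fₜ ∩ E) - P_{K,Ω}(E) + ε t²`,
where `Fₜ = Ψₜ(E)`, are written without subtraction, in `[0, ∞]`. -/
def IsStableSet {n : ℕ} (K : EuclideanSpace ℝ (Fin n) → ℝ)
    (Ω E : Set (EuclideanSpace ℝ (Fin n))) : Prop :=
  kPerimeter K Ω E < ⊤ ∧
  ∀ X, IsTestField Ω X → ∀ Ψ, IsIntegralFlow X Ψ → ∀ ε : ℝ, 0 < ε →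
    ∃ t₀ : ℝ, 0 < t₀ ∧ ∀ t ∈ Ioo (-t₀) t₀,
      kPerimeter K Ω E ≤ kPerimeter K Ω (Ψ t '' E ∪ E) + ENNReal.ofReal (ε * t ^ 2) ∧
      kPerimeter K Ω E ≤ kPerimeter K Ω (Ψ t '' E ∩ E) + ENNReal.ofReal (ε * t ^ 2)

/-- `E` is stable in every compact set: it is a stable set for `P_{K,Ω}` for every bounded
open `Ω`. -/
def IsStableInEveryCompact {n : ℕ} (K : EuclideanSpace ℝ (Fin n) → ℝ)
    (E : Set (EuclideanSpace ℝ (Fin n))) : Prop :=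
  ∀ Ω : Set (EuclideanSpace ℝ (Fin n)), IsOpen Ω → Bornology.IsBounded Ω → IsStableSet K Ω E

/-- Closed half-spaces `{x | ⟨ν, x⟩ ≤ c}` with `|ν| = 1` (half-planes if `n = 2`). -/
def IsHalfSpace {n : ℕ} (H : Set (EuclideanSpace ℝ (Fin n))) : Prop :=
  ∃ ν : EuclideanSpace ℝ (Fin n), ‖ν‖ = 1 ∧ ∃ c : ℝ, H = {x | inner ℝ ν x ≤ c}

/-! Necessity rests on one inequality. Move points in a fixed direction `e` with a cutoff speed `φ`
of Lipschitz constant `l`. In the sum of the energies of the forward and backward images of `E` the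
first-order terms cancel, so the sum is at most `(2 + C l² t²) P(E)`
(`kPerimeter_image_shear_add_le`). The perimeter is submodular, and its defect contains the
interaction of `F \ E` with `E \ F` (`kPerimeter_union_add_inter_le`). Stability under unions and
intersections therefore bounds this interaction by `(C l² P(E) + η) t²` (`IsStableSet.excess_le`).
If `φ = 1` on a ball of radius `R` and `l ~ 1 / R`, the motion is a translation there. The lower
bound on `K` then shows that, inside a ball of radius `r`, the measure gained times the measure lost
is at most `C r^(2+s) (P_{3R} / R² + η) t²` (`exists_gained_mul_lost_le`).

This is used at two scales. With `R` comparable to `r`, gained minus lost is `O(r |t|)` for every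
set, so the product bound becomes a bound of BV type on the sum. Integrated against `K` it gives
`P_r ≤ C r^(2-s) + ε P_{12r}`, and a covering argument absorbs the last term: `P_R ≤ C R^(2-s)`
(`exists_kPerimeter_ball_le`). With `R → ∞`, the quotient `P_{3R} / R²` tends to `0`; here the
dimension two enters. The product is then `o(t²)`, and composing small translations shows that no
translation both gains and loses (`translate_ae_le_or_ge`). A set totally ordered with all its
translates is trivial or a half-plane (`ae_eq_empty_or_univ_or_halfSpace`).

Sufficiency is a calibration argument: a half-plane minimizes the perimeter among all measurable
sets that agree with it outside `Ω` (`kPerimeter_halfSpace_le`). -/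

/-- The Euclidean plane. -/
abbrev Plane := EuclideanSpace ℝ (Fin 2)

/-! ### Pointwise estimates for the kernel -/

namespace IsL2Kernel

variable {s lam Lam : ℝ} {K : Plane → ℝ}

lemma pos (hK : IsL2Kernel 2 s lam Lam K) (hlam : 0 < lam) {z : Plane} (hz : z ≠ 0) : 0 < K z :=
  lt_of_lt_of_le (div_pos hlam (Real.rpow_pos_of_pos (norm_pos_iff.2 hz) _)) (hK.lower z hz)

lemma upper_le (hK : IsL2Kernel 2 s lam Lam K) (hlam : 0 < lam) {z : Plane} (hz : z ≠ 0) :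
    Lam / ‖z‖ ^ (2 + s) ≤ Lam / lam * K z := by
  have h1 := hK.lower z hz
  have h2 := hK.upper z hz
  have hp : 0 < ‖z‖ ^ (2 + s) := Real.rpow_pos_of_pos (norm_pos_iff.2 hz) _
  have hpos := hK.pos hlam hz
  push_cast at h1 h2
  have hL : 0 < Lam := by
    by_contra h
    push Not at h
    have : Lam / ‖z‖ ^ (2 + s) ≤ 0 := div_nonpos_of_nonpos_of_nonneg h hp.le
    linarith
  calc Lam / ‖z‖ ^ (2 + s) = Lam / lam * (lam / ‖z‖ ^ (2 + s)) := by field_simp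
    _ ≤ _ := by gcongr

lemma Lam_pos (hK : IsL2Kernel 2 s lam Lam K) (hlam : 0 < lam) : 0 < Lam := by
  obtain ⟨z, hz⟩ := exists_ne (0 : Plane)
  have h1 := hK.pos hlam hz
  have h2 := hK.upper z hz
  have hp : 0 < ‖z‖ ^ (((2 : ℕ) : ℝ) + s) := Real.rpow_pos_of_pos (norm_pos_iff.2 hz) _
  by_contra h
  push Not at h
  have : Lam / ‖z‖ ^ (((2 : ℕ) : ℝ) + s) ≤ 0 := div_nonpos_of_nonpos_of_nonneg h hp.le
  linarith

lemma hasDerivAt_line_of_lineDifferentiableAt {f : Plane → ℝ} {z e : Plane} {b : ℝ}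
    (h : LineDifferentiableAt ℝ f (z + b • e) e) :
    HasDerivAt (fun τ : ℝ => f (z + τ • e)) (lineDeriv ℝ f (z + b • e) e) b := by
  have h1 := h.hasLineDerivAt
  unfold HasLineDerivAt at h1
  have h0 : HasDerivAt (fun t : ℝ => f (z + b • e + t • e)) (lineDeriv ℝ f (z + b • e) e)
      (b - b) := by simpa using h1
  have h2 := h0.comp_sub_const b b
  convert! h2 using 2 with τ
  congr 1
  module

lemma half_norm_le {z e : Plane} (he : ‖e‖ = 1) {b : ℝ} (hb : |b| ≤ ‖z‖ / 2) :
    ‖z‖ / 2 ≤ ‖z + b • e‖ := by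
  have h : ‖z‖ ≤ ‖z + b • e‖ + ‖b • e‖ := by
    calc ‖z‖ = ‖(z + b • e) - b • e‖ := by congr 1; abel
      _ ≤ _ := norm_sub_le _ _
  rw [norm_smul, he, Real.norm_eq_abs, mul_one] at h
  linarith

lemma half_ne_zero {z e : Plane} (hz : z ≠ 0) (he : ‖e‖ = 1) {b : ℝ} (hb : |b| ≤ ‖z‖ / 2) :
    z + b • e ≠ 0 := by
  have := half_norm_le he hb
  have hz' := norm_pos_iff.2 hz
  intro h
  rw [h, norm_zero] at this
  linarith

lemma div_rpow_le_of_half_le (hs : s ∈ Ioo (0 : ℝ) 1) (hL : 0 < Lam) {z w : Plane} (hz : z ≠ 0)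
    (hw : ‖z‖ / 2 ≤ ‖w‖) : Lam / ‖w‖ ^ (2 + s) ≤ 8 * (Lam / ‖z‖ ^ (2 + s)) := by
  have hz' := norm_pos_iff.2 hz
  have hp : 0 < ‖z‖ ^ (2 + s) := Real.rpow_pos_of_pos hz' _
  have h1 : (‖z‖ / 2) ^ (2 + s) ≤ ‖w‖ ^ (2 + s) :=
    Real.rpow_le_rpow (by positivity) hw (by linarith [hs.1])
  have h2 : ‖z‖ ^ (2 + s) / 8 ≤ (‖z‖ / 2) ^ (2 + s) := by
    rw [Real.div_rpow hz'.le (by norm_num)]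
    gcongr
    calc (2 : ℝ) ^ (2 + s) ≤ 2 ^ (3 : ℝ) :=
          Real.rpow_le_rpow_of_exponent_le (by norm_num) (by linarith [hs.2])
      _ = 8 := by norm_num
  calc Lam / ‖w‖ ^ (2 + s) ≤ Lam / (‖z‖ ^ (2 + s) / 8) := by
        gcongr
        exact h2.trans h1
    _ = _ := by field_simp

/-- The factor is `16 = 2 * 8`: at a point of norm at least `‖z‖ / 2`, the weight `‖w‖` costs `2`
and the power `2 + s < 3` costs `8`. For the second derivative below it is `32 = 4 * 8`. -/
lemma abs_lineDeriv_le (hs : s ∈ Ioo (0 : ℝ) 1) (hK : IsL2Kernel 2 s lam Lam K) (hlam : 0 < lam)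
    {z w e : Plane} (he : ‖e‖ = 1) (hz : z ≠ 0) (hw : ‖z‖ / 2 ≤ ‖w‖) :
    |lineDeriv ℝ K w e| ≤ 16 * (Lam / ‖z‖ ^ (2 + s)) / ‖z‖ := by
  have hz' := norm_pos_iff.2 hz
  have hw0 : w ≠ 0 := norm_pos_iff.1 (by linarith)
  have h1 := (le_max_left _ _).trans (hK.deriv_bound w hw0 e he)
  push_cast at h1
  have h2 := h1.trans (div_rpow_le_of_half_le hs (hK.Lam_pos hlam) hz hw)
  rw [le_div_iff₀ hz']
  nlinarith [abs_nonneg (lineDeriv ℝ K w e)]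

lemma abs_lineDeriv_lineDeriv_le (hs : s ∈ Ioo (0 : ℝ) 1) (hK : IsL2Kernel 2 s lam Lam K)
    (hlam : 0 < lam) {z w e : Plane} (he : ‖e‖ = 1) (hz : z ≠ 0) (hw : ‖z‖ / 2 ≤ ‖w‖) :
    |lineDeriv ℝ (fun y => lineDeriv ℝ K y e) w e| ≤ 32 * (Lam / ‖z‖ ^ (2 + s)) / ‖z‖ ^ 2 := by
  have hz' := norm_pos_iff.2 hz
  have hw0 : w ≠ 0 := norm_pos_iff.1 (by linarith)
  have h1 := (le_max_right _ _).trans (hK.deriv_bound w hw0 e he)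
  push_cast at h1
  have h2 := h1.trans (div_rpow_le_of_half_le hs (hK.Lam_pos hlam) hz hw)
  rw [le_div_iff₀ (by positivity)]
  have h3 : ‖z‖ ^ 2 ≤ 4 * ‖w‖ ^ 2 := by nlinarith
  nlinarith [mul_le_mul_of_nonneg_left h3
    (abs_nonneg (lineDeriv ℝ (fun y => lineDeriv ℝ K y e) w e))]

lemma abs_le_of_mem_uIcc {a b c : ℝ} (ha : |a| ≤ c) (hb : b ∈ uIcc 0 a) : |b| ≤ c := by
  rcases le_total 0 a with h | h
  · rw [uIcc_of_le h] at hb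
    rw [abs_of_nonneg hb.1]
    exact hb.2.trans ((le_abs_self a).trans ha)
  · rw [uIcc_of_ge h] at hb
    rw [abs_of_nonpos hb.2]
    have := neg_abs_le a
    linarith [hb.1]

lemma abs_sub_le (hs : s ∈ Ioo (0 : ℝ) 1) (hK : IsL2Kernel 2 s lam Lam K) (hlam : 0 < lam)
    {z e : Plane} (he : ‖e‖ = 1) (hz : z ≠ 0) {a : ℝ} (ha : |a| ≤ ‖z‖ / 2) :
    |K (z + a • e) - K z| ≤ 16 * (Lam / ‖z‖ ^ (2 + s)) / ‖z‖ * |a| := by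
  have h := (convex_uIcc (0 : ℝ) a).norm_image_sub_le_of_norm_hasDerivWithin_le
    (f := fun τ : ℝ => K (z + τ • e)) (f' := fun τ => lineDeriv ℝ K (z + τ • e) e)
    (C := 16 * (Lam / ‖z‖ ^ (2 + s)) / ‖z‖)
    (fun b hb => (hasDerivAt_line_of_lineDifferentiableAt
      (hK.differentiable _ (half_ne_zero hz he (abs_le_of_mem_uIcc ha hb)) e he)).hasDerivWithinAt)
    (fun b hb => abs_lineDeriv_le hs hK hlam he hz (half_norm_le he (abs_le_of_mem_uIcc ha hb)))
    left_mem_uIcc right_mem_uIcc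
  simpa using h

/-- The mean value inequality is used twice on the line through `z`: for `∂ₑK` between `z - b e` and
`z + b e`, then for the even function `τ ↦ K(z + τe) + K(z - τe)`, whose derivative is the
difference just bounded. Only derivatives along `e` enter. -/
lemma abs_second_difference_le (hs : s ∈ Ioo (0 : ℝ) 1) (hK : IsL2Kernel 2 s lam Lam K)
    (hlam : 0 < lam) {z e : Plane} (he : ‖e‖ = 1) (hz : z ≠ 0) {a : ℝ} (ha : |a| ≤ ‖z‖ / 2) :
    |K (z + a • e) + K (z + (-a) • e) - 2 * K z|
      ≤ 64 * (Lam / ‖z‖ ^ (2 + s)) / ‖z‖ ^ 2 * a ^ 2 := by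
  set M := 32 * (Lam / ‖z‖ ^ (2 + s)) / ‖z‖ ^ 2 with hM
  have hM0 : 0 ≤ M := (abs_nonneg _).trans
    (abs_lineDeriv_lineDeriv_le hs hK hlam he hz (w := z) (by linarith [norm_nonneg z]))
  have habs : ∀ b : ℝ, |b| ≤ ‖z‖ / 2 → |-b| ≤ ‖z‖ / 2 := fun b hb => by rwa [abs_neg]
  have hd : ∀ b : ℝ, |b| ≤ ‖z‖ / 2 →
      |lineDeriv ℝ K (z + b • e) e - lineDeriv ℝ K (z + (-b) • e) e| ≤ M * |2 * b| := by
    intro b hb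
    have hmem : ∀ c ∈ uIcc (-b) b, |c| ≤ ‖z‖ / 2 := by
      intro c hc
      rw [mem_uIcc] at hc
      rw [abs_le] at hb ⊢
      rcases hc with hc | hc <;> constructor <;> linarith [hb.1, hb.2, hc.1, hc.2]
    have h := (convex_uIcc (-b) b).norm_image_sub_le_of_norm_hasDerivWithin_le
      (f := fun τ : ℝ => lineDeriv ℝ K (z + τ • e) e)
      (f' := fun τ => lineDeriv ℝ (fun y => lineDeriv ℝ K y e) (z + τ • e) e) (C := M)
      (fun c hc => (hasDerivAt_line_of_lineDifferentiableAt
        (f := fun y => lineDeriv ℝ K y e) (hK.differentiable_two _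
          (half_ne_zero hz he (hmem c hc)) e he)).hasDerivWithinAt)
      (fun c hc => abs_lineDeriv_lineDeriv_le hs hK hlam he hz (half_norm_le he (hmem c hc)))
      left_mem_uIcc right_mem_uIcc
    have h2 : b - -b = 2 * b := by ring
    simpa [h2] using h
  have h := (convex_uIcc (0 : ℝ) a).norm_image_sub_le_of_norm_hasDerivWithin_le
    (f := fun τ : ℝ => K (z + τ • e) + K (z + (-τ) • e))
    (f' := fun τ => lineDeriv ℝ K (z + τ • e) e + lineDeriv ℝ K (z + (-τ) • e) e * (-1))
    (C := M * |2 * a|)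
    (fun b hb => by
      have hb' := abs_le_of_mem_uIcc ha hb
      have h1 := hasDerivAt_line_of_lineDifferentiableAt
        (hK.differentiable _ (half_ne_zero hz he hb') e he)
      have h2 := hasDerivAt_line_of_lineDifferentiableAt
        (hK.differentiable _ (half_ne_zero hz he (habs b hb')) e he)
      have h3 := HasDerivAt.comp b h2 (hasDerivAt_neg b)
      exact (h1.add h3).hasDerivWithinAt)
    (fun b hb => by
      have hb' := abs_le_of_mem_uIcc ha hb
      have hba : |b| ≤ |a| := abs_le_of_mem_uIcc le_rfl hb
      have := hd b hb'
      rw [Real.norm_eq_abs, mul_neg_one, ← sub_eq_add_neg]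
      refine this.trans ?_
      rw [abs_mul, abs_mul]
      gcongr)
    left_mem_uIcc right_mem_uIcc
  have h2 : M * |2 * a| * |a| = 64 * (Lam / ‖z‖ ^ (2 + s)) / ‖z‖ ^ 2 * a ^ 2 := by
    rw [abs_mul, mul_assoc, mul_assoc, abs_mul_abs_self, hM, abs_of_pos (by norm_num : (0:ℝ) < 2)]
    ring
  simp only [Real.norm_eq_abs, sub_zero, neg_zero, zero_smul, add_zero] at h
  rw [h2] at h
  rwa [two_mul (K z)]

/-- The left side equals `(A + B)(1 + PQ) + (A - B)(P + Q)`, and in the second product both factors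
are of order `u`. The constant is `146 = 2 + 64 + 16 + 64`, by `c ≤ k` and `u² ≤ 1/4`. -/
lemma second_variation_algebra {A B c k u P Q : ℝ} (hA : 0 ≤ A) (hB : 0 ≤ B) (hu : 0 ≤ u)
    (hu2 : u ≤ 1 / 2) (hck : c ≤ k) (hk : 0 ≤ k) (hD : |A - B| ≤ 32 * k * u)
    (hS : A + B ≤ 2 * c + 64 * k * u ^ 2) (hP : |P| ≤ u) (hQ : |Q| ≤ u) :
    A * ((1 + P) * (1 + Q)) + B * ((1 - P) * (1 - Q)) ≤ 2 * c + 146 * k * u ^ 2 := by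
  have hprod : |P * Q| ≤ u ^ 2 := by
    rw [abs_mul, sq]; gcongr
  have hsum : |P + Q| ≤ 2 * u := (abs_add_le _ _).trans (by linarith)
  have hx : (A + B) * (1 + P * Q) ≤ (2 * c + 64 * k * u ^ 2) * (1 + u ^ 2) := by
    have := (abs_le.1 hprod).2
    calc (A + B) * (1 + P * Q) ≤ (A + B) * (1 + u ^ 2) := by gcongr
      _ ≤ _ := by gcongr
  have hy : (A - B) * (P + Q) ≤ 64 * k * u ^ 2 := by
    calc (A - B) * (P + Q) ≤ |(A - B) * (P + Q)| := le_abs_self _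
      _ = |A - B| * |P + Q| := abs_mul _ _
      _ ≤ (32 * k * u) * (2 * u) := by gcongr
      _ = _ := by ring
  have hu4 : u ^ 2 ≤ 1 / 4 := by nlinarith
  have h1 : c * u ^ 2 ≤ k * u ^ 2 := by gcongr
  have h2 : k * u ^ 2 * u ^ 2 ≤ k * u ^ 2 * (1 / 4) := by gcongr
  linarith

/-- The pointwise second variation estimate for the kernel transported by a flow in a fixed
direction `e`: `τ` is the difference of the speeds and `p`, `q` the divergences at the two
points. -/
lemma second_variation_le (hs : s ∈ Ioo (0 : ℝ) 1) (hK : IsL2Kernel 2 s lam Lam K)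
    (hlam : 0 < lam) {z e : Plane} (he : ‖e‖ = 1) (hz : z ≠ 0) {l t τ p q : ℝ}
    (hτ : |τ| ≤ l * ‖z‖) (hp : |p| ≤ l) (hq : |q| ≤ l) (ht : |t| * l ≤ 1 / 2) :
    K (z + (t * τ) • e) * ((1 + t * p) * (1 + t * q))
      + K (z + (-(t * τ)) • e) * ((1 - t * p) * (1 - t * q))
      ≤ (2 + 146 * (Lam / lam) * l ^ 2 * t ^ 2) * K z := by
  have hz' := norm_pos_iff.2 hz
  have hu0 : 0 ≤ |t| * l := mul_nonneg (abs_nonneg _) ((abs_nonneg _).trans hp)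
  have hKz := hK.pos hlam hz
  have hkK := hK.upper_le hlam hz
  have hKk : K z ≤ Lam / ‖z‖ ^ (2 + s) := by simpa using hK.upper z hz
  have ha : |t * τ| ≤ |t| * l * ‖z‖ := by
    rw [abs_mul, mul_assoc]; gcongr
  have ha2 : |t * τ| ≤ ‖z‖ / 2 :=
    ha.trans ((mul_le_mul_of_nonneg_right ht hz'.le).trans_eq (by ring))
  have ha3 : |-(t * τ)| ≤ ‖z‖ / 2 := by rwa [abs_neg]
  have h1 := hK.abs_sub_le hs hlam he hz ha2
  have h1' := hK.abs_sub_le hs hlam he hz ha3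
  have h2 := hK.abs_second_difference_le hs hlam he hz ha2
  rw [abs_neg] at h1'
  have hk0 := hKz.le.trans hKk
  generalize Lam / ‖z‖ ^ (2 + s) = k at h1 h1' h2 hkK hKk hk0
  have e1 : 16 * k / ‖z‖ * |t * τ| ≤ 16 * k * (|t| * l) := by
    calc 16 * k / ‖z‖ * |t * τ| ≤ 16 * k / ‖z‖ * (|t| * l * ‖z‖) := by gcongr
      _ = _ := by field_simp
  have e2 : 64 * k / ‖z‖ ^ 2 * (t * τ) ^ 2 ≤ 64 * k * (|t| * l) ^ 2 := by
    rw [← sq_abs (t * τ)]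
    calc 64 * k / ‖z‖ ^ 2 * |t * τ| ^ 2 ≤ 64 * k / ‖z‖ ^ 2 * (|t| * l * ‖z‖) ^ 2 := by gcongr
      _ = _ := by field_simp
  have hA0 := (hK.pos hlam (half_ne_zero hz he ha2)).le
  have hB0 := (hK.pos hlam (half_ne_zero hz he ha3)).le
  have hpq : |t * p| ≤ |t| * l := by rw [abs_mul]; gcongr
  have hpq' : |t * q| ≤ |t| * l := by rw [abs_mul]; gcongr
  have hl : l ^ 2 * t ^ 2 = (|t| * l) ^ 2 := by rw [mul_pow, sq_abs]; ring
  have e3 : (2 + 146 * (Lam / lam) * l ^ 2 * t ^ 2) * K z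
      = 2 * K z + 146 * (Lam / lam * K z) * (|t| * l) ^ 2 := by rw [← hl]; ring
  rw [e3]
  generalize |t| * l = u at *
  generalize K (z + (t * τ) • e) = A at *
  generalize K (z + (-(t * τ)) • e) = B at *
  have hD : |A - B| ≤ 32 * k * u := by
    have : A - B = (A - K z) - (B - K z) := by ring
    rw [this]
    refine (abs_sub _ _).trans ?_
    linarith
  have hS : A + B ≤ 2 * K z + 64 * k * u ^ 2 := by
    have := le_abs_self (A + B - 2 * K z)
    linarith
  refine (second_variation_algebra hA0 hB0 hu0 ht hKk hk0 hD hS hpq hpq').trans ?_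
  gcongr

/-- Line derivatives alone do not give continuity, but their bound is uniform in the direction:
comparing `w` with `z` along `w - z` gives a Lipschitz estimate at `z`. Measurability of `K`
follows. -/
lemma continuousAt (hs : s ∈ Ioo (0 : ℝ) 1) (hK : IsL2Kernel 2 s lam Lam K) (hlam : 0 < lam)
    {z : Plane} (hz : z ≠ 0) : ContinuousAt K z := by
  have hz' := norm_pos_iff.2 hz
  set M := 16 * (Lam / ‖z‖ ^ (2 + s)) / ‖z‖
  have hb : ∀ᶠ w in nhds z, dist (K w) (K z) ≤ M * ‖w - z‖ := by
    filter_upwards [Metric.closedBall_mem_nhds z (half_pos hz')] with w hw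
    rw [mem_closedBall_iff_norm] at hw
    rcases eq_or_ne w z with rfl | hne
    · simp
    have hn : ‖w - z‖ ≠ 0 := norm_ne_zero_iff.2 (sub_ne_zero.2 hne)
    have h := hK.abs_sub_le hs hlam (e := ‖w - z‖⁻¹ • (w - z)) (a := ‖w - z‖)
      (by rw [norm_smul, norm_inv, norm_norm, inv_mul_cancel₀ hn]) hz (by simpa using hw)
    rw [smul_smul, mul_inv_cancel₀ hn, one_smul, add_sub_cancel, abs_norm] at h
    exact h
  rw [ContinuousAt, tendsto_iff_dist_tendsto_zero]
  refine squeeze_zero' (Filter.Eventually.of_forall fun _ => dist_nonneg) hb ?_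
  have hc : Continuous fun w : Plane => M * ‖w - z‖ := by fun_prop
  simpa using hc.tendsto z

lemma measurable (hs : s ∈ Ioo (0 : ℝ) 1) (hK : IsL2Kernel 2 s lam Lam K) (hlam : 0 < lam) :
    Measurable K :=
  measurable_of_continuousOn_compl_singleton 0
    fun _ hz => (hK.continuousAt hs hlam hz).continuousWithinAt

end IsL2Kernel

/-! ### The perimeter as a measure on pairs, and submodularity -/

/-- The measure `K(x - y) dx dy` on pairs of points. -/
noncomputable def kMeasure (K : Plane → ℝ) : Measure (Plane × Plane) :=
  (volume.prod volume).withDensity fun p => ENNReal.ofReal (K (p.1 - p.2))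

/-- The pairs of points of which at least one lies in `Ω`. -/
def near (Ω : Set Plane) : Set (Plane × Plane) := {p | p.1 ∈ Ω ∨ p.2 ∈ Ω}

lemma measurableSet_near {Ω : Set Plane} (hΩ : MeasurableSet Ω) : MeasurableSet (near Ω) :=
  (measurable_fst hΩ).union (measurable_snd hΩ)

lemma near_mono {Ω Ω' : Set Plane} (h : Ω ⊆ Ω') : near Ω ⊆ near Ω' :=
  fun _ hp => hp.imp (fun a => h a) (fun a => h a)

section KMeasure

variable {K : Plane → ℝ}

lemma measurable_ofReal_kernel (hK : Measurable K) :
    Measurable fun p : Plane × Plane => ENNReal.ofReal (K (p.1 - p.2)) :=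
  (hK.comp (measurable_fst.sub measurable_snd)).ennreal_ofReal

lemma kMeasure_apply (hK : Measurable K) {S : Set (Plane × Plane)} (hS : MeasurableSet S) :
    kMeasure K S = ∫⁻ x, ∫⁻ y, S.indicator (fun p => ENNReal.ofReal (K (p.1 - p.2))) (x, y) := by
  rw [kMeasure, withDensity_apply _ hS, ← lintegral_indicator hS, lintegral_prod]
  exact ((measurable_ofReal_kernel hK).indicator hS).aemeasurable

lemma kInteraction_eq (hK : Measurable K) {A B : Set Plane} (hA : MeasurableSet A)
    (hB : MeasurableSet B) : kInteraction K A B = kMeasure K (A ×ˢ B) := by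
  rw [kMeasure_apply hK (hA.prod hB), kInteraction, ← lintegral_indicator hA]
  refine lintegral_congr fun x => ?_
  by_cases hx : x ∈ A
  · rw [indicator_of_mem hx, ← lintegral_indicator hB]
    refine lintegral_congr fun y => ?_
    by_cases hy : y ∈ B <;> simp [hx, hy]
  · simp [hx]

lemma kInteraction_congr {A A' B B' : Set Plane} (hA : A =ᵐ[volume] A') (hB : B =ᵐ[volume] B') :
    kInteraction K A B = kInteraction K A' B' := by
  simp only [kInteraction, Measure.restrict_congr_set hA, Measure.restrict_congr_set hB]

lemma kPerimeter_congr {Ω E E' : Set Plane} (h : E =ᵐ[volume] E') :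
    kPerimeter K Ω E = kPerimeter K Ω E' := by
  have h1 : (E ∩ Ω : Set Plane) =ᵐ[volume] (E' ∩ Ω : Set Plane) := h.inter (ae_eq_refl Ω)
  have h2 : (Eᶜ ∩ Ω : Set Plane) =ᵐ[volume] (E'ᶜ ∩ Ω : Set Plane) :=
    h.compl.inter (ae_eq_refl Ω)
  have h3 : (E \ Ω : Set Plane) =ᵐ[volume] (E' \ Ω : Set Plane) := h.diff (ae_eq_refl Ω)
  have h4 : (Eᶜ \ Ω : Set Plane) =ᵐ[volume] (E'ᶜ \ Ω : Set Plane) := h.compl.diff (ae_eq_refl Ω)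
  rw [kPerimeter, kPerimeter, kInteraction_congr h1 h2, kInteraction_congr h1 h4,
    kInteraction_congr h3 h2]

/-- The three interactions are the disjoint pieces of a single set of pairs. Comparisons of
perimeters thus reduce to inclusions of sets or inequalities between indicators. -/
lemma kPerimeter_eq (hK : Measurable K) {Ω E : Set Plane} (hΩ : MeasurableSet Ω)
    (hE : MeasurableSet E) : kPerimeter K Ω E = kMeasure K ((E ×ˢ Eᶜ) ∩ near Ω) := by
  rw [kPerimeter, kInteraction_eq hK (hE.inter hΩ) (hE.compl.inter hΩ),
    kInteraction_eq hK (hE.inter hΩ) (hE.compl.diff hΩ),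
    kInteraction_eq hK (hE.diff hΩ) (hE.compl.inter hΩ),
    ← measure_union _ ((hE.inter hΩ).prod (hE.compl.diff hΩ)),
    ← measure_union _ ((hE.diff hΩ).prod (hE.compl.inter hΩ))]
  · congr 1
    ext ⟨x, y⟩
    simp only [near, mem_union, mem_prod, mem_inter_iff, mem_sdiff, mem_ofPred_eq]
    tauto
  · rw [Set.disjoint_left]
    rintro ⟨x, y⟩ h1 h2
    simp only [mem_union, mem_prod, mem_inter_iff, mem_sdiff] at h1 h2
    tauto
  · rw [Set.disjoint_left]
    rintro ⟨x, y⟩ h1 h2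
    simp only [mem_prod, mem_inter_iff, mem_sdiff] at h1 h2
    tauto

lemma kMeasure_swap (hK : Measurable K) (hev : ∀ z, K z = K (-z)) {S : Set (Plane × Plane)}
    (hS : MeasurableSet S) : kMeasure K (Prod.swap ⁻¹' S) = kMeasure K S := by
  rw [kMeasure, withDensity_apply _ (measurable_swap hS), withDensity_apply _ hS,
    ← (Measure.measurePreserving_swap (μ := (volume : Measure Plane))
      (ν := (volume : Measure Plane))).setLIntegral_comp_preimage hS (measurable_ofReal_kernel hK)]
  refine lintegral_congr fun p => ?_
  rw [hev, neg_sub, Prod.fst_swap, Prod.snd_swap]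

lemma kMeasure_apply_sub (hK : Measurable K) {S : Set (Plane × Plane)} (hS : MeasurableSet S) :
    kMeasure K S
      = ∫⁻ x, ∫⁻ h, {h | (x, x - h) ∈ S}.indicator (fun h => ENNReal.ofReal (K h)) h := by
  rw [kMeasure_apply hK hS]
  refine lintegral_congr fun x => ?_
  rw [← lintegral_sub_left_eq_self _ x]
  refine lintegral_congr fun h => ?_
  by_cases hh : (x, x - h) ∈ S <;> simp [hh, indicator]

lemma measurable_shear : Measurable fun p : Plane × Plane => (p.1, p.1 - p.2) :=
  measurable_fst.prodMk (measurable_fst.sub measurable_snd)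

/-- Fubini in the variables `x` and `h = x - y`. The slice at fixed `h` compares a set with its
translate by `h`, which links the perimeter to translations. -/
lemma kMeasure_eq_lintegral_volume (hK : Measurable K) {S : Set (Plane × Plane)}
    (hS : MeasurableSet S) :
    kMeasure K S = ∫⁻ h, ENNReal.ofReal (K h) * volume {x | (x, x - h) ∈ S} := by
  rw [kMeasure_apply_sub hK hS, lintegral_lintegral_swap]
  · refine lintegral_congr fun h => ?_
    have hm : MeasurableSet {x | (x, x - h) ∈ S} :=
      (measurable_id.prodMk (measurable_id.sub_const h)) hS
    rw [← lintegral_indicator_const hm]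
    refine lintegral_congr fun x => ?_
    by_cases hh : (x, x - h) ∈ S <;> simp [hh, indicator]
  · have : (Function.uncurry fun x h : Plane =>
        {h | (x, x - h) ∈ S}.indicator (fun h => ENNReal.ofReal (K h)) h)
        = ((fun p : Plane × Plane => (p.1, p.1 - p.2)) ⁻¹' S).indicator
          (fun p => ENNReal.ofReal (K p.2)) := by
      ext ⟨x, h⟩
      simp only [Function.uncurry, indicator]
      rfl
    rw [this]
    exact ((hK.comp measurable_snd).ennreal_ofReal.indicator (measurable_shear hS)).aemeasurable

/-- The measure `K(x - y) dx dy` is invariant under point reflection of `y` in `x`. -/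
lemma kMeasure_reflect (hK : Measurable K) (hev : ∀ z, K z = K (-z)) {S : Set (Plane × Plane)}
    (hS : MeasurableSet S) :
    kMeasure K {p | (p.1, p.1 + (p.1 - p.2)) ∈ S} = kMeasure K S := by
  have hS' : MeasurableSet {p : Plane × Plane | (p.1, p.1 + (p.1 - p.2)) ∈ S} :=
    (measurable_fst.prodMk (measurable_fst.add (measurable_fst.sub measurable_snd))) hS
  rw [kMeasure_apply_sub hK hS, kMeasure_apply_sub hK hS']
  refine lintegral_congr fun x => ?_
  rw [← lintegral_neg_eq_self]
  refine lintegral_congr fun h => ?_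
  simp only [indicator, mem_ofPred_eq, ← hev]
  congr 1
  simp [sub_eq_add_neg]

lemma kPerimeter_mono_domain (hK : Measurable K) {Ω Ω' E : Set Plane} (hΩ : MeasurableSet Ω)
    (hΩ' : MeasurableSet Ω') (hE : MeasurableSet E) (h : Ω ⊆ Ω') :
    kPerimeter K Ω E ≤ kPerimeter K Ω' E := by
  rw [kPerimeter_eq hK hΩ hE, kPerimeter_eq hK hΩ' hE]
  exact measure_mono (inter_subset_inter_right _ (near_mono h))

lemma kPerimeter_le_sum (hK : Measurable K) {ι : Type*} (t : Finset ι) {Ω E : Set Plane}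
    {U : ι → Set Plane} (hΩ : MeasurableSet Ω) (hU : ∀ i, MeasurableSet (U i))
    (hE : MeasurableSet E) (h : Ω ⊆ ⋃ i ∈ t, U i) :
    kPerimeter K Ω E ≤ ∑ i ∈ t, kPerimeter K (U i) E := by
  simp only [kPerimeter_eq hK (hU _) hE]
  rw [kPerimeter_eq hK hΩ hE]
  refine (measure_mono ?_).trans (measure_biUnion_finset_le t _)
  rintro ⟨x, y⟩ ⟨hxy, hn⟩
  rcases hn with hn | hn
  · obtain ⟨i, hi, hx⟩ := mem_iUnion₂.1 (h hn)
    exact mem_iUnion₂.2 ⟨i, hi, hxy, Or.inl hx⟩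
  · obtain ⟨i, hi, hx⟩ := mem_iUnion₂.1 (h hn)
    exact mem_iUnion₂.2 ⟨i, hi, hxy, Or.inr hx⟩

/-- Submodularity with part of its defect kept: a pair from `F \ E` to `E \ F` leaves `F`, but
leaves neither the union nor the intersection. The opposite pairs, which leave `E`, are discarded.
The inequality holds pair by pair. -/
lemma kPerimeter_union_add_inter_le (hK : Measurable K) {Ω E F : Set Plane}
    (hΩ : MeasurableSet Ω) (hE : MeasurableSet E) (hF : MeasurableSet F) :
    kPerimeter K Ω (F ∪ E) + kPerimeter K Ω (F ∩ E) + kMeasure K (((F \ E) ×ˢ (E \ F)) ∩ near Ω)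
      ≤ kPerimeter K Ω F + kPerimeter K Ω E := by
  have hN := measurableSet_near hΩ
  rw [kPerimeter_eq hK hΩ hE, kPerimeter_eq hK hΩ hF, kPerimeter_eq hK hΩ (hF.union hE),
    kPerimeter_eq hK hΩ (hF.inter hE)]
  have m1 := ((hF.union hE).prod (hF.union hE).compl).inter hN
  have m2 := ((hF.inter hE).prod (hF.inter hE).compl).inter hN
  have m3 := ((hF.diff hE).prod (hE.diff hF)).inter hN
  have m4 := (hF.prod hF.compl).inter hN
  have m5 := (hE.prod hE.compl).inter hN
  simp only [← lintegral_indicator_one m1, ← lintegral_indicator_one m2,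
    ← lintegral_indicator_one m3, ← lintegral_indicator_one m4, ← lintegral_indicator_one m5]
  rw [← lintegral_add_left (measurable_one.indicator m1),
    ← lintegral_add_right _ (measurable_one.indicator m3),
    ← lintegral_add_left (measurable_one.indicator m4)]
  refine lintegral_mono fun p => ?_
  rcases p with ⟨x, y⟩
  by_cases h1 : x ∈ E <;> by_cases h2 : x ∈ F <;> by_cases h3 : y ∈ E <;> by_cases h4 : y ∈ F <;>
    by_cases h5 : (x, y) ∈ near Ω <;> simp [indicator, h1, h2, h3, h4, h5]

end KMeasure

/-! ### Integrals of the kernel near and far from the origin -/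

/-- The area of the unit disc. -/
noncomputable def discArea : ℝ := volume.real (Metric.ball (0 : Plane) 1)

lemma discArea_nonneg : 0 ≤ discArea := measureReal_nonneg

lemma finrank_plane : Module.finrank ℝ Plane = 2 := by simp

/-- The weight `y ^ (finrank - 1) = y` is that of polar coordinates. The tail of `|h|^(-2-s)`
converges because `s > 0`; in `integral_Ioc_indicator`, `|h|^(-1-s)` is integrable at the origin
because `s < 1`. -/
lemma integral_Ioi_indicator {ρ s : ℝ} (hs : 0 < s) (hρ : 0 < ρ) :
    IntegrableOn (fun y : ℝ => y ^ (Module.finrank ℝ Plane - 1) •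
        (Ioi ρ).indicator (fun r : ℝ => r ^ (-(2 + s))) y) (Ioi 0) ∧
      ∫ y in Ioi (0 : ℝ), y ^ (Module.finrank ℝ Plane - 1) •
        (Ioi ρ).indicator (fun r : ℝ => r ^ (-(2 + s))) y = ρ ^ (-s) / s := by
  have h : (fun y : ℝ => y ^ (Module.finrank ℝ Plane - 1) •
        (Ioi ρ).indicator (fun r : ℝ => r ^ (-(2 + s))) y)
      = (Ioi ρ).indicator (fun r : ℝ => r ^ (-s - 1)) := by
    ext y
    by_cases hy : y ∈ Ioi ρ
    · have hy0 : 0 < y := hρ.trans hy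
      rw [indicator_of_mem hy, indicator_of_mem hy, finrank_plane, smul_eq_mul,
        ← Real.rpow_natCast, ← Real.rpow_add hy0]
      congr 1; push_cast; ring
    · simp [indicator_of_notMem hy]
  rw [h]
  constructor
  · refine (IntegrableOn.integrable_indicator ?_ measurableSet_Ioi).integrableOn
    exact integrableOn_Ioi_rpow_of_lt (by linarith) hρ
  · rw [integral_indicator measurableSet_Ioi, Measure.restrict_restrict measurableSet_Ioi,
      inter_eq_left.2 (Ioi_subset_Ioi hρ.le), integral_Ioi_rpow_of_lt (by linarith) hρ]
    have : -s - 1 + 1 = -s := by ring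
    rw [this, neg_div_neg_eq]

lemma integral_Ioc_indicator {ρ s : ℝ} (hs : s < 1) (hρ : 0 < ρ) :
    IntegrableOn (fun y : ℝ => y ^ (Module.finrank ℝ Plane - 1) •
        (Ioc 0 ρ).indicator (fun r : ℝ => r ^ (-(1 + s))) y) (Ioi 0) ∧
      ∫ y in Ioi (0 : ℝ), y ^ (Module.finrank ℝ Plane - 1) •
        (Ioc 0 ρ).indicator (fun r : ℝ => r ^ (-(1 + s))) y = ρ ^ (1 - s) / (1 - s) := by
  have h : (fun y : ℝ => y ^ (Module.finrank ℝ Plane - 1) •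
        (Ioc 0 ρ).indicator (fun r : ℝ => r ^ (-(1 + s))) y)
      = (Ioc 0 ρ).indicator (fun r : ℝ => r ^ (-s)) := by
    ext y
    by_cases hy : y ∈ Ioc 0 ρ
    · have hy0 : 0 < y := hy.1
      rw [indicator_of_mem hy, indicator_of_mem hy, finrank_plane, smul_eq_mul,
        ← Real.rpow_natCast, ← Real.rpow_add hy0]
      congr 1; push_cast; ring
    · simp [indicator_of_notMem hy]
  have hi : IntervalIntegrable (fun r : ℝ => r ^ (-s)) volume 0 ρ :=
    intervalIntegral.intervalIntegrable_rpow' (by linarith)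
  rw [h]
  constructor
  · refine (IntegrableOn.integrable_indicator ?_ measurableSet_Ioc).integrableOn
    exact (intervalIntegrable_iff_integrableOn_Ioc_of_le hρ.le).1 hi
  · rw [integral_indicator measurableSet_Ioc, Measure.restrict_restrict measurableSet_Ioc,
      inter_eq_left.2 Ioc_subset_Ioi_self, ← intervalIntegral.integral_of_le hρ.le,
      integral_rpow (Or.inl (by linarith))]
    have : -s + 1 = 1 - s := by ring
    rw [this, Real.zero_rpow (by linarith), sub_zero]

lemma lintegral_fun_norm_plane {f : ℝ → ℝ} (hf : ∀ r, 0 ≤ f r)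
    (hi : IntegrableOn (fun y : ℝ => y ^ (Module.finrank ℝ Plane - 1) • f y) (Ioi 0)) :
    ∫⁻ x : Plane, ENNReal.ofReal (f ‖x‖) = ENNReal.ofReal (2 * discArea *
      ∫ y in Ioi (0 : ℝ), y ^ (Module.finrank ℝ Plane - 1) • f y) := by
  rw [← ofReal_integral_eq_lintegral_ofReal ((integrable_fun_norm_addHaar volume).2 hi)
    (Filter.Eventually.of_forall fun x => hf _), integral_fun_norm_addHaar]
  congr 1
  rw [finrank_plane, discArea]
  simp only [nsmul_eq_mul, smul_eq_mul]
  push_cast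
  ring

section KernelIntegrals

variable {s lam Lam : ℝ} {K : Plane → ℝ}

lemma IsL2Kernel.setLIntegral_outside_le (hs : s ∈ Ioo (0 : ℝ) 1) (hK : IsL2Kernel 2 s lam Lam K)
    (hlam : 0 < lam) {ρ : ℝ} (hρ : 0 < ρ) :
    ∫⁻ h in {h | ρ < ‖h‖}, ENNReal.ofReal (K h)
      ≤ ENNReal.ofReal (2 * discArea * Lam / s * ρ ^ (-s)) := by
  have hL := hK.Lam_pos hlam
  obtain ⟨hi, he⟩ := integral_Ioi_indicator hs.1 hρ
  have hf : ∀ r, 0 ≤ (Ioi ρ).indicator (fun r : ℝ => r ^ (-(2 + s))) r := fun r =>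
    indicator_nonneg (fun r hr => Real.rpow_nonneg (hρ.trans hr).le _) r
  have hm : MeasurableSet {h : Plane | ρ < ‖h‖} := measurableSet_lt measurable_const measurable_norm
  calc ∫⁻ h in {h | ρ < ‖h‖}, ENNReal.ofReal (K h)
      ≤ ∫⁻ h, ENNReal.ofReal Lam
          * ENNReal.ofReal ((Ioi ρ).indicator (fun r : ℝ => r ^ (-(2 + s))) ‖h‖) := by
        rw [← lintegral_indicator hm]
        refine lintegral_mono fun h => ?_
        by_cases hh : ρ < ‖h‖
        · have hh0 : 0 < ‖h‖ := hρ.trans hh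
          rw [indicator_of_mem (by exact hh), indicator_of_mem (by exact hh),
            ← ENNReal.ofReal_mul hL.le]
          refine ENNReal.ofReal_le_ofReal ?_
          have := hK.upper h (norm_pos_iff.1 hh0)
          rw [Real.rpow_neg hh0.le, ← div_eq_mul_inv]
          exact_mod_cast this
        · rw [indicator_of_notMem (by exact hh)]
          exact zero_le
    _ = _ := by
        rw [lintegral_const_mul' _ _ ENNReal.ofReal_ne_top, lintegral_fun_norm_plane hf hi, he,
          ← ENNReal.ofReal_mul hL.le]
        congr 1
        ring

lemma IsL2Kernel.setLIntegral_inside_le (hs : s ∈ Ioo (0 : ℝ) 1) (hK : IsL2Kernel 2 s lam Lam K)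
    (hlam : 0 < lam) {ρ : ℝ} (hρ : 0 < ρ) :
    ∫⁻ h in {h | ‖h‖ ≤ ρ}, ENNReal.ofReal (K h) * ENNReal.ofReal ‖h‖
      ≤ ENNReal.ofReal (2 * discArea * Lam / (1 - s) * ρ ^ (1 - s)) := by
  have hL := hK.Lam_pos hlam
  obtain ⟨hi, he⟩ := integral_Ioc_indicator hs.2 hρ
  have hf : ∀ r, 0 ≤ (Ioc 0 ρ).indicator (fun r : ℝ => r ^ (-(1 + s))) r := fun r =>
    indicator_nonneg (fun r hr => Real.rpow_nonneg hr.1.le _) r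
  have hm : MeasurableSet {h : Plane | ‖h‖ ≤ ρ} := measurableSet_le measurable_norm measurable_const
  calc ∫⁻ h in {h | ‖h‖ ≤ ρ}, ENNReal.ofReal (K h) * ENNReal.ofReal ‖h‖
      ≤ ∫⁻ h, ENNReal.ofReal Lam
          * ENNReal.ofReal ((Ioc 0 ρ).indicator (fun r : ℝ => r ^ (-(1 + s))) ‖h‖) := by
        rw [← lintegral_indicator hm]
        refine lintegral_mono fun h => ?_
        rcases eq_or_ne h 0 with rfl | h0
        · simp [indicator]
        have hh0 : 0 < ‖h‖ := norm_pos_iff.2 h0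
        by_cases hh : ‖h‖ ≤ ρ
        · rw [indicator_of_mem (by exact hh), indicator_of_mem (mem_Ioc.2 ⟨hh0, hh⟩),
            ← ENNReal.ofReal_mul hL.le, ← ENNReal.ofReal_mul (hK.pos hlam h0).le]
          refine ENNReal.ofReal_le_ofReal ?_
          have := hK.upper h h0
          push_cast at this
          calc K h * ‖h‖ ≤ Lam / ‖h‖ ^ (2 + s) * ‖h‖ := by gcongr
            _ = Lam * ‖h‖ ^ (-(1 + s)) := by
              rw [div_mul_eq_mul_div, mul_div_assoc, Real.rpow_neg hh0.le,
                show (2 + s) = (1 + s) + 1 by ring, Real.rpow_add_one hh0.ne']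
              field_simp
        · rw [indicator_of_notMem (by exact hh)]
          exact zero_le
    _ = _ := by
        rw [lintegral_const_mul' _ _ ENNReal.ofReal_ne_top, lintegral_fun_norm_plane hf hi, he,
          ← ENNReal.ofReal_mul hL.le]
        congr 1
        ring

end KernelIntegrals

/-! ### Points gained and lost under a translation -/

open Metric
open scoped NNReal ContDiff

/-- The points of the ball which are gained when `E` is translated by `h`. -/
def gained (E : Set Plane) (h z : Plane) (r : ℝ) : Set Plane := ball z r ∩ {x | x - h ∈ E ∧ x ∉ E}

/-- The points of the ball which are lost when `E` is translated by `h`. -/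
def lost (E : Set Plane) (h z : Plane) (r : ℝ) : Set Plane := ball z r ∩ {x | x ∈ E ∧ x - h ∉ E}

section Translation

variable {E : Set Plane}

lemma measurableSet_translate (hE : MeasurableSet E) (h : Plane) :
    MeasurableSet {x | x - h ∈ E} := (measurable_id.sub_const h) hE

lemma measurableSet_gained (hE : MeasurableSet E) (h z : Plane) (r : ℝ) :
    MeasurableSet (gained E h z r) :=
  measurableSet_ball.inter ((measurableSet_translate hE h).inter hE.compl)

lemma measurableSet_lost (hE : MeasurableSet E) (h z : Plane) (r : ℝ) :
    MeasurableSet (lost E h z r) :=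
  measurableSet_ball.inter (hE.inter (measurableSet_translate hE h).compl)

lemma volume_ball_ne_top (z : Plane) (r : ℝ) : volume (ball z r) ≠ ⊤ := measure_ball_lt_top.ne

lemma volume_real_ball {r : ℝ} (hr : 0 ≤ r) (z : Plane) :
    volume.real (ball z r) = r ^ 2 * discArea := by
  rw [Measure.real, Measure.addHaar_ball _ _ hr, finrank_plane, ENNReal.toReal_mul,
    ENNReal.toReal_ofReal (by positivity)]
  rfl

lemma volume_real_annulus_le {r d : ℝ} (hr : 0 ≤ r) (hd : 0 ≤ d) (hdr : d ≤ r) (z : Plane) :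
    volume.real (ball z (r + d) \ ball z r) ≤ 3 * discArea * r * d := by
  rw [measureReal_sdiff (ball_subset_ball (by linarith)) measurableSet_ball,
    volume_real_ball (by linarith), volume_real_ball hr]
  have := discArea_nonneg
  have : d * d * discArea ≤ r * d * discArea := by gcongr
  linarith

lemma volume_translate (h : Plane) (S : Set Plane) : volume {x | x - h ∈ S} = volume S := by
  rw [← measure_preimage_add_right (volume : Measure Plane) (-h) S]
  simp only [sub_eq_add_neg]
  rfl

lemma volume_real_translate (h : Plane) (S : Set Plane) :
    volume.real {x | x - h ∈ S} = volume.real S := by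
  rw [Measure.real, Measure.real, volume_translate]

/-- Both sides measure the part in the ball of the union of `E` and its translate. -/
lemma gained_balance (hE : MeasurableSet E) (h z : Plane) (r : ℝ) :
    volume.real (gained E h z r) + volume.real (ball z r ∩ E)
      = volume.real (lost E h z r) + volume.real (ball z r ∩ {x | x - h ∈ E}) := by
  have hf : ∀ S : Set Plane, S ⊆ ball z r → volume S ≠ ⊤ := fun S hS =>
    measure_ne_top_of_subset hS (volume_ball_ne_top z r)
  rw [← measureReal_union (μ := volume) (s₁ := gained E h z r) (s₂ := ball z r ∩ E) ?_
    (measurableSet_ball.inter hE) (hf _ inter_subset_left) (hf _ inter_subset_left),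
    ← measureReal_union (μ := volume) (s₁ := lost E h z r) ?_
    (measurableSet_ball.inter (measurableSet_translate hE h)) (hf _ inter_subset_left)
    (hf _ inter_subset_left)]
  · congr 1
    ext x
    simp only [gained, lost, mem_union, mem_inter_iff, mem_ofPred_eq]
    tauto
  · rw [Set.disjoint_left]
    rintro x ⟨_, h1⟩ ⟨_, h2⟩
    exact h1.2 h2
  · rw [Set.disjoint_left]
    rintro x ⟨_, h1⟩ ⟨_, h2⟩
    exact h1.2 h2

/-- By `gained_balance` the difference compares the measure of `E` in a ball with that in a
translated ball, so the error lives in an annulus of width `‖h‖`. No regularity of `E` is needed. -/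
lemma abs_gained_sub_lost_le (hE : MeasurableSet E) {h z : Plane} {r : ℝ} (hr : 0 ≤ r)
    (hh : ‖h‖ ≤ r) :
    |volume.real (gained E h z r) - volume.real (lost E h z r)| ≤ 3 * discArea * r * ‖h‖ := by
  have hbal := gained_balance hE h z r
  have hA := volume_real_annulus_le hr (norm_nonneg h) hh z
  have h1 : volume.real (ball z r ∩ {x | x - h ∈ E})
      ≤ volume.real (ball z r ∩ E) + 3 * discArea * r * ‖h‖ := by
    calc volume.real (ball z r ∩ {x | x - h ∈ E})
        ≤ volume.real {x | x - h ∈ (ball z r ∩ E) ∪ (ball z (r + ‖h‖) \ ball z r)} := by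
          refine measureReal_mono ?_ ?_
          · rintro x ⟨hx, hxE⟩
            have : x - h ∈ ball z (r + ‖h‖) := by
              rw [mem_ball_iff_norm] at hx ⊢
              calc ‖x - h - z‖ = ‖(x - z) - h‖ := by congr 1; abel
                _ ≤ ‖x - z‖ + ‖h‖ := norm_sub_le _ _
                _ < _ := by linarith
            by_cases hb : x - h ∈ ball z r
            · exact Or.inl ⟨hb, hxE⟩
            · exact Or.inr ⟨this, hb⟩
          · have hsub : {x | x - h ∈ (ball z r ∩ E) ∪ (ball z (r + ‖h‖) \ ball z r)}
                ⊆ ball (z + h) (r + ‖h‖) := by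
              intro x hx
              have h2 : x - h ∈ ball z (r + ‖h‖) := by
                rcases hx with hx | hx
                · exact ball_subset_ball (by linarith [norm_nonneg h]) hx.1
                · exact hx.1
              rw [mem_ball_iff_norm] at h2 ⊢
              rwa [← sub_sub, sub_right_comm]
            exact measure_ne_top_of_subset hsub (volume_ball_ne_top _ _)
      _ = volume.real ((ball z r ∩ E) ∪ (ball z (r + ‖h‖) \ ball z r)) := volume_real_translate _ _
      _ ≤ volume.real (ball z r ∩ E) + volume.real (ball z (r + ‖h‖) \ ball z r) :=
          measureReal_union_le _ _
      _ ≤ _ := by linarith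
  have h2 : volume.real (ball z r ∩ E)
      ≤ volume.real (ball z r ∩ {x | x - h ∈ E}) + 3 * discArea * r * ‖h‖ := by
    calc volume.real (ball z r ∩ E) = volume.real {x | x - h ∈ ball z r ∩ E} :=
          (volume_real_translate _ _).symm
      _ ≤ volume.real ((ball z r ∩ {x | x - h ∈ E}) ∪ (ball z (r + ‖h‖) \ ball z r)) := by
          refine measureReal_mono ?_ ?_
          · rintro x ⟨hx, hxE⟩
            have : x ∈ ball z (r + ‖h‖) := by
              rw [mem_ball_iff_norm] at hx ⊢
              calc ‖x - z‖ = ‖(x - h - z) + h‖ := by congr 1; abel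
                _ ≤ ‖x - h - z‖ + ‖h‖ := norm_add_le _ _
                _ < _ := by linarith
            by_cases hb : x ∈ ball z r
            · exact Or.inl ⟨hb, hxE⟩
            · exact Or.inr ⟨this, hb⟩
          · refine measure_ne_top_of_subset ?_ (volume_ball_ne_top z (r + ‖h‖))
            refine union_subset ?_ sdiff_subset
            exact inter_subset_left.trans (ball_subset_ball (by linarith [norm_nonneg h]))
      _ ≤ volume.real (ball z r ∩ {x | x - h ∈ E}) + volume.real (ball z (r + ‖h‖) \ ball z r) :=
          measureReal_union_le _ _
      _ ≤ _ := by linarith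
  rw [abs_le]
  constructor <;> linarith

/-- Translations in `m` equal steps. -/
lemma gained_nsmul_le (h z : Plane) {r d : ℝ} (m : ℕ)
    (hm : m * ‖h‖ ≤ d) :
    volume.real (gained E ((m : ℝ) • h) z r) ≤ m * volume.real (gained E h z (r + d)) := by
  induction m with
  | zero => simp [gained]
  | succ m ih =>
    push_cast at hm ⊢
    have ih' := ih (by linarith [norm_nonneg h])
    have hsub : gained E (((m : ℝ) + 1) • h) z r
        ⊆ gained E ((m : ℝ) • h) z r ∪ {x | x - (m : ℝ) • h ∈ gained E h z (r + d)} := by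
      rintro x ⟨hx, hx1, hx2⟩
      -- Along the chain `x`, `x - m h`, `x - (m + 1) h` membership changes either within the first
      -- `m` steps or in the last one.
      by_cases hmid : x - (m : ℝ) • h ∈ E
      · exact Or.inl ⟨hx, hmid, hx2⟩
      · refine Or.inr ⟨?_, ?_, hmid⟩
        · rw [mem_ball_iff_norm] at hx ⊢
          have hn : ‖(m : ℝ) • h‖ ≤ d := by
            rw [norm_smul, Real.norm_natCast]; linarith [norm_nonneg h]
          calc ‖x - (m : ℝ) • h - z‖ = ‖(x - z) - (m : ℝ) • h‖ := by congr 1; abel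
            _ ≤ ‖x - z‖ + ‖(m : ℝ) • h‖ := norm_sub_le _ _
            _ < _ := by linarith
        · rwa [add_smul, one_smul, ← sub_sub] at hx1
    have hfin : volume {x | x - (m : ℝ) • h ∈ gained E h z (r + d)} ≠ ⊤ := by
      rw [volume_translate]
      exact measure_ne_top_of_subset inter_subset_left (volume_ball_ne_top _ _)
    calc volume.real (gained E (((m : ℝ) + 1) • h) z r)
        ≤ volume.real (gained E ((m : ℝ) • h) z r
            ∪ {x | x - (m : ℝ) • h ∈ gained E h z (r + d)}) := by
          refine measureReal_mono hsub (measure_union_ne_top ?_ hfin)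
          exact measure_ne_top_of_subset inter_subset_left (volume_ball_ne_top _ _)
      _ ≤ _ := measureReal_union_le _ _
      _ ≤ m * volume.real (gained E h z (r + d)) + volume.real (gained E h z (r + d)) := by
          rw [volume_real_translate]; gcongr
      _ = _ := by ring

lemma lost_eq_gained_compl (h z : Plane) (r : ℝ) : lost E h z r = gained Eᶜ h z r := by
  ext x
  simp only [gained, lost, mem_inter_iff, mem_ofPred_eq, mem_compl_iff]
  tauto

lemma lost_nsmul_le (h z : Plane) {r d : ℝ} (m : ℕ)
    (hm : m * ‖h‖ ≤ d) :
    volume.real (lost E ((m : ℝ) • h) z r) ≤ m * volume.real (lost E h z (r + d)) := by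
  rw [lost_eq_gained_compl, lost_eq_gained_compl]
  exact gained_nsmul_le h z m hm

end Translation

/-! ### From translations to the perimeter -/

section TranslationEnergy

variable {s lam Lam : ℝ} {K : Plane → ℝ}

/-- The perimeter in a ball is controlled by the measure of the symmetric differences of the set
with its translates. -/
lemma kPerimeter_ball_le_of_translation (hs : s ∈ Ioo (0 : ℝ) 1) (hlam : 0 < lam)
    (hK : IsL2Kernel 2 s lam Lam K) {E : Set Plane} (hE : MeasurableSet E) {z : Plane}
    {r V δ : ℝ} (hr : 0 < r) (hδ : 0 < δ) (hδ1 : δ ≤ 1) (hV0 : 0 ≤ V)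
    (hV : ∀ h, ‖h‖ ≤ r → volume.real (gained E h z r) + volume.real (lost E h z r) ≤ V * ‖h‖) :
    kPerimeter K (ball z r) E ≤ ENNReal.ofReal (4 * discArea * Lam *
      (discArea * r ^ 2 * (δ * r) ^ (-s) / s + V * (δ * r) ^ (1 - s) / (1 - s))) := by
  have hKm := hK.measurable hs hlam
  have hL := hK.Lam_pos hlam
  have hρ : 0 < δ * r := mul_pos hδ hr
  have hDA := discArea_nonneg
  set X : Set (Plane × Plane) :=
    {p | p.1 ∈ ball z r} ∩ ({p | p.1 ∈ E ∧ p.2 ∉ E} ∪ {p | p.1 ∉ E ∧ p.2 ∈ E}) with hX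
  have hm1 : MeasurableSet {p : Plane × Plane | p.1 ∈ E} := measurable_fst hE
  have hm2 : MeasurableSet {p : Plane × Plane | p.2 ∈ E} := measurable_snd hE
  have hXm : MeasurableSet X := (measurable_fst measurableSet_ball).inter
    ((hm1.inter hm2.compl).union (hm1.compl.inter hm2))
  have h1 : kPerimeter K (ball z r) E ≤ kMeasure K X + kMeasure K X := by
    rw [kPerimeter_eq hKm measurableSet_ball hE]
    calc _ ≤ kMeasure K (X ∪ Prod.swap ⁻¹' X) := by
          refine measure_mono ?_
          rintro ⟨x, y⟩ ⟨⟨hx, hy⟩, hn | hn⟩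
          · exact Or.inl ⟨hn, Or.inl ⟨hx, hy⟩⟩
          · exact Or.inr ⟨hn, Or.inr ⟨hy, hx⟩⟩
      _ ≤ _ := measure_union_le _ _
      _ = _ := by rw [kMeasure_swap hKm hK.even hXm]
  have hT : ∀ h, volume {x | (x, x - h) ∈ X} = ENNReal.ofReal
      (volume.real (gained E h z r) + volume.real (lost E h z r)) := by
    intro h
    have e : {x | (x, x - h) ∈ X} = gained E h z r ∪ lost E h z r := by
      ext x
      simp only [hX, gained, lost, mem_inter_iff, mem_union, mem_ofPred_eq]
      tauto
    have hf : ∀ S : Set Plane, S ⊆ ball z r → volume S ≠ ⊤ := fun S hS =>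
      measure_ne_top_of_subset hS (volume_ball_ne_top z r)
    rw [e, ← measureReal_union (μ := volume) (s₁ := gained E h z r) ?_ (measurableSet_lost hE h z r)
      (hf _ inter_subset_left) (hf _ inter_subset_left),
      ofReal_measureReal (s := gained E h z r ∪ lost E h z r) (hf _ (union_subset inter_subset_left inter_subset_left))]
    rw [Set.disjoint_left]
    rintro x ⟨_, h1⟩ ⟨_, h2⟩
    exact h1.2 h2.1
  have hTb : ∀ h, volume {x | (x, x - h) ∈ X} ≤ ENNReal.ofReal (discArea * r ^ 2) := by
    intro h
    calc _ ≤ volume (ball z r) := measure_mono fun x hx => hx.1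
      _ = _ := by
        rw [mul_comm, ← volume_real_ball hr.le z, ofReal_measureReal (volume_ball_ne_top z r)]
  have hms : MeasurableSet {h : Plane | ‖h‖ ≤ δ * r} :=
    measurableSet_le measurable_norm measurable_const
  have hc : {h : Plane | ‖h‖ ≤ δ * r}ᶜ = {h | δ * r < ‖h‖} := by ext; simp
  have h2 : kMeasure K X ≤ ENNReal.ofReal (2 * discArea * Lam *
      (discArea * r ^ 2 * (δ * r) ^ (-s) / s + V * (δ * r) ^ (1 - s) / (1 - s))) := by
    rw [kMeasure_eq_lintegral_volume hKm hXm, ← lintegral_add_compl _ hms, hc]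
    -- The integral is split at `‖h‖ = δ r`: short translations use the bound `V ‖h‖`, long ones
    -- only the area of the ball. A small `δ` later makes the coefficient of `V` small.
    calc _ ≤ ENNReal.ofReal V
            * (∫⁻ h in {h | ‖h‖ ≤ δ * r}, ENNReal.ofReal (K h) * ENNReal.ofReal ‖h‖)
          + ENNReal.ofReal (discArea * r ^ 2)
            * ∫⁻ h in {h | δ * r < ‖h‖}, ENNReal.ofReal (K h) := by
          rw [← lintegral_const_mul' _ _ ENNReal.ofReal_ne_top,
            ← lintegral_const_mul' _ _ ENNReal.ofReal_ne_top]
          refine add_le_add (setLIntegral_mono' hms fun h hh => ?_) (lintegral_mono fun h => ?_)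
          · rw [hT, mul_left_comm, ← ENNReal.ofReal_mul hV0]
            gcongr
            exact hV h ((show ‖h‖ ≤ δ * r from hh).trans (by nlinarith))
          · rw [mul_comm]
            gcongr
            exact hTb h
      _ ≤ ENNReal.ofReal V * ENNReal.ofReal (2 * discArea * Lam / (1 - s) * (δ * r) ^ (1 - s))
          + ENNReal.ofReal (discArea * r ^ 2)
            * ENNReal.ofReal (2 * discArea * Lam / s * (δ * r) ^ (-s)) := by
          gcongr
          · exact hK.setLIntegral_inside_le hs hlam hρ
          · exact hK.setLIntegral_outside_le hs hlam hρ
      _ = _ := by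
          have hs1 : 0 < 1 - s := by linarith [hs.2]
          have hs0 := hs.1
          have hp1 := Real.rpow_nonneg hρ.le (1 - s)
          have hp2 := Real.rpow_nonneg hρ.le (-s)
          rw [← ENNReal.ofReal_mul hV0, ← ENNReal.ofReal_mul (by positivity),
            ← ENNReal.ofReal_add (by positivity) (by positivity)]
          congr 1
          ring
  refine h1.trans ((add_le_add h2 h2).trans_eq ?_)
  have hs1 : 0 < 1 - s := by linarith [hs.2]
  have hs0 := hs.1
  have hp1 := Real.rpow_nonneg hρ.le (1 - s)
  have hp2 := Real.rpow_nonneg hρ.le (-s)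
  rw [← ENNReal.ofReal_add (by positivity) (by positivity)]
  congr 1
  ring

end TranslationEnergy

/-! ### Half-planes minimize the perimeter -/

section HalfPlane

variable {s lam Lam : ℝ} {K : Plane → ℝ}

/-- The pairs of points at distance more than `ρ`. -/
def farPairs (ρ : ℝ) : Set (Plane × Plane) := {p | ρ < ‖p.1 - p.2‖}

lemma measurableSet_farPairs (ρ : ℝ) : MeasurableSet (farPairs ρ) :=
  measurableSet_lt measurable_const (measurable_fst.sub measurable_snd).norm

lemma kMeasure_near_inter_farPairs_ne_top (hs : s ∈ Ioo (0 : ℝ) 1) (hlam : 0 < lam)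
    (hK : IsL2Kernel 2 s lam Lam K) {Ω : Set Plane} (hΩ : MeasurableSet Ω)
    (hΩf : volume Ω ≠ ⊤) {ρ : ℝ} (hρ : 0 < ρ) : kMeasure K (near Ω ∩ farPairs ρ) ≠ ⊤ := by
  have hKm := hK.measurable hs hlam
  set X : Set (Plane × Plane) := {p | p.1 ∈ Ω} ∩ farPairs ρ with hX
  have hXm : MeasurableSet X := (measurable_fst hΩ).inter (measurableSet_farPairs ρ)
  have h1 : near Ω ∩ farPairs ρ ⊆ X ∪ Prod.swap ⁻¹' X := by
    rintro ⟨x, y⟩ ⟨hn | hn, hf⟩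
    · exact Or.inl ⟨hn, hf⟩
    · refine Or.inr ⟨hn, ?_⟩
      simpa [farPairs, norm_sub_rev] using hf
  have hms : MeasurableSet {h : Plane | ρ < ‖h‖} := measurableSet_lt measurable_const measurable_norm
  have h2 : kMeasure K X ≤ volume Ω * ∫⁻ h in {h | ρ < ‖h‖}, ENNReal.ofReal (K h) := by
    rw [kMeasure_eq_lintegral_volume hKm hXm, ← lintegral_const_mul' _ _ hΩf,
      ← lintegral_indicator hms]
    refine lintegral_mono fun h => ?_
    by_cases hh : ρ < ‖h‖
    · rw [indicator_of_mem (by exact hh), mul_comm]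
      gcongr
      exact fun x hx => hx.1
    · have : {x : Plane | (x, x - h) ∈ X} = ∅ := by
        ext x
        simp [hX, farPairs, hh]
      simp [this]
  have h3 : kMeasure K X < ⊤ := h2.trans_lt (ENNReal.mul_lt_top hΩf.lt_top
    ((hK.setLIntegral_outside_le hs hlam hρ).trans_lt ENNReal.ofReal_lt_top))
  refine ((measure_mono h1).trans_lt ((measure_union_le _ _).trans_lt ?_)).ne
  rw [kMeasure_swap hKm hK.even hXm]
  exact ENNReal.add_lt_top.2 ⟨h3, h3⟩

/-- The pairs of points ordered in direction `ν`. -/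
def orderedPairs (ν : Plane) : Set (Plane × Plane) := {p | inner ℝ ν p.1 < inner ℝ ν p.2}

lemma measurableSet_orderedPairs (ν : Plane) : MeasurableSet (orderedPairs ν) := by
  unfold orderedPairs
  refine measurableSet_lt ?_ ?_ <;> fun_prop

/-- The calibration identity: among the pairs ordered in direction `ν`, those leaving `F` minus
those entering `F` depend only on the part of `F` outside `Ω`. -/
lemma calibration_identity (hs : s ∈ Ioo (0 : ℝ) 1) (hlam : 0 < lam)
    (hK : IsL2Kernel 2 s lam Lam K) {Ω F : Set Plane} (hΩ : MeasurableSet Ω)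
    (hΩf : volume Ω ≠ ⊤) {ρ : ℝ} (hρ : 0 < ρ) (ν : Plane) (hF : MeasurableSet F)
    (m : Measure (Plane × Plane))
    (hm : m = (kMeasure K).restrict (near Ω ∩ farPairs ρ ∩ orderedPairs ν)) :
    m.real (F ×ˢ Fᶜ) - m.real (Fᶜ ×ˢ F)
      = m.real ((F \ Ω) ×ˢ univ) - m.real (univ ×ˢ (F \ Ω)) := by
  have hKm := hK.measurable hs hlam
  have hW := ((measurableSet_near hΩ).inter (measurableSet_farPairs ρ)).inter
    (measurableSet_orderedPairs ν)
  -- Discarding the pairs at distance at most `ρ` makes every quantity finite, so that subtraction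
  -- is meaningful.
  have hfin : IsFiniteMeasure m := by
    rw [hm]
    refine isFiniteMeasure_restrict.2 (ne_top_of_le_ne_top
      (kMeasure_near_inter_farPairs_ne_top hs hlam hK hΩ hΩf hρ) ?_)
    exact measure_mono inter_subset_left
  have u1 : m.real (F ×ˢ Fᶜ) + m.real (F ×ˢ F) = m.real (F ×ˢ univ) := by
    rw [← measureReal_union (by
      rw [Set.disjoint_left]; rintro p h1 h2; exact h1.2 h2.2) (hF.prod hF), ← prod_union,
      compl_union_self]
  have u2 : m.real (Fᶜ ×ˢ F) + m.real (F ×ˢ F) = m.real (univ ×ˢ F) := by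
    rw [← measureReal_union (by
      rw [Set.disjoint_left]; rintro p h1 h2; exact h1.1 h2.1) (hF.prod hF), ← union_prod,
      compl_union_self]
  have u3 : m.real ((F ∩ Ω) ×ˢ univ) + m.real ((F \ Ω) ×ˢ univ) = m.real (F ×ˢ univ) := by
    rw [← measureReal_union (by
      rw [Set.disjoint_left]; rintro p h1 h2; exact h2.1.2 h1.1.2)
      ((hF.diff hΩ).prod MeasurableSet.univ), ← union_prod, inter_union_sdiff]
  have u4 : m.real (univ ×ˢ (F ∩ Ω)) + m.real (univ ×ˢ (F \ Ω)) = m.real (univ ×ˢ F) := by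
    rw [← measureReal_union (by
      rw [Set.disjoint_left]; rintro p h1 h2; exact h2.2.2 h1.2.2)
      (MeasurableSet.univ.prod (hF.diff hΩ)), ← prod_union, inter_union_sdiff]
  -- Swapping a pair and then reflecting the second point in the first preserves `kMeasure`, the
  -- distance and the order along `ν`. It exchanges pairs ending in `F ∩ Ω` with pairs starting
  -- there; both kinds meet `Ω` automatically.
  have u5 : m.real ((F ∩ Ω) ×ˢ univ) = m.real (univ ×ˢ (F ∩ Ω)) := by
    have hA : MeasurableSet ({p : Plane × Plane | p.2 ∈ F ∩ Ω} ∩ farPairs ρ ∩ orderedPairs ν) :=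
      ((measurable_snd (hF.inter hΩ)).inter (measurableSet_farPairs ρ)).inter
        (measurableSet_orderedPairs ν)
    have hB : MeasurableSet ({p : Plane × Plane | p.1 ∈ F ∩ Ω} ∩ farPairs ρ ∩ orderedPairs ν) :=
      ((measurable_fst (hF.inter hΩ)).inter (measurableSet_farPairs ρ)).inter
        (measurableSet_orderedPairs ν)
    rw [Measure.real, Measure.real, hm, Measure.restrict_apply' hW, Measure.restrict_apply' hW]
    congr 1
    have e1 : (F ∩ Ω) ×ˢ univ ∩ (near Ω ∩ farPairs ρ ∩ orderedPairs ν)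
        = {p : Plane × Plane | p.1 ∈ F ∩ Ω} ∩ farPairs ρ ∩ orderedPairs ν := by
      ext ⟨x, y⟩
      simp only [near, mem_inter_iff, mem_prod, mem_univ, mem_ofPred_eq]
      tauto
    have e2 : univ ×ˢ (F ∩ Ω) ∩ (near Ω ∩ farPairs ρ ∩ orderedPairs ν)
        = {p : Plane × Plane | p.2 ∈ F ∩ Ω} ∩ farPairs ρ ∩ orderedPairs ν := by
      ext ⟨x, y⟩
      simp only [near, mem_inter_iff, mem_prod, mem_univ, mem_ofPred_eq]
      tauto
    rw [e1, e2, ← kMeasure_swap hKm hK.even hA, ← kMeasure_reflect hKm hK.even (measurable_swap hA)]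
    congr 1
    ext ⟨x, y⟩
    have hn : x + (x - y) - x = x - y := by abel
    have hi : inner ℝ ν (x + (x - y)) < inner ℝ ν x ↔ inner ℝ ν x < inner ℝ ν y := by
      rw [inner_add_right, inner_sub_right]
      constructor <;> intro h <;> linarith
    simp only [farPairs, orderedPairs, mem_inter_iff, mem_preimage, mem_ofPred_eq, Prod.swap,
      hn, hi]
  linarith

/-- In `calibration_identity` the right sides for `F` and `H` coincide. All pairs leaving `H` are
ordered along `ν` and no ordered pair enters it, so for `H` the left side is the full truncated
perimeter; for `F` it is at most the perimeter. The truncation is removed by monotone convergence.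
-/
lemma kPerimeter_halfSpace_le (hs : s ∈ Ioo (0 : ℝ) 1) (hlam : 0 < lam)
    (hK : IsL2Kernel 2 s lam Lam K) {Ω F H : Set Plane} (hΩ : MeasurableSet Ω)
    (hΩf : volume Ω ≠ ⊤) (hF : MeasurableSet F) (hHm : MeasurableSet H) (hH : IsHalfSpace H)
    (hFH : F \ Ω = H \ Ω) : kPerimeter K Ω H ≤ kPerimeter K Ω F := by
  have hKm := hK.measurable hs hlam
  obtain ⟨ν, -, c, hHe⟩ := hH
  have hord : H ×ˢ Hᶜ ⊆ orderedPairs ν := by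
    rintro ⟨x, y⟩ ⟨hx, hy⟩
    rw [hHe] at hx hy
    simp only [mem_compl_iff, mem_ofPred_eq, not_le] at hx hy
    exact lt_of_le_of_lt hx hy
  rw [kPerimeter_eq hKm hΩ hHm, kPerimeter_eq hKm hΩ hF]
  have key : ∀ n : ℕ, kMeasure K ((H ×ˢ Hᶜ) ∩ near Ω ∩ farPairs (1 / ((n : ℝ) + 1)))
      ≤ kMeasure K ((F ×ˢ Fᶜ) ∩ near Ω) := by
    intro n
    set ρ : ℝ := 1 / ((n : ℝ) + 1)
    have hρ : 0 < ρ := by positivity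
    have hW := ((measurableSet_near hΩ).inter (measurableSet_farPairs ρ)).inter
      (measurableSet_orderedPairs ν)
    set m := (kMeasure K).restrict (near Ω ∩ farPairs ρ ∩ orderedPairs ν) with hm
    have hfin : IsFiniteMeasure m := by
      rw [hm]
      refine isFiniteMeasure_restrict.2 (ne_top_of_le_ne_top
        (kMeasure_near_inter_farPairs_ne_top hs hlam hK hΩ hΩf hρ) ?_)
      exact measure_mono inter_subset_left
    have h1 := calibration_identity hs hlam hK hΩ hΩf hρ ν hF m hm
    have h2 := calibration_identity hs hlam hK hΩ hΩf hρ ν hHm m hm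
    rw [hFH] at h1
    have h3 : m.real (Hᶜ ×ˢ H) = 0 := by
      rw [Measure.real, hm, Measure.restrict_apply' hW]
      have : Hᶜ ×ˢ H ∩ (near Ω ∩ farPairs ρ ∩ orderedPairs ν) = ∅ := by
        ext ⟨x, y⟩
        simp only [mem_inter_iff, mem_empty_iff_false, iff_false]
        rintro ⟨⟨hx, hy⟩, -, ho⟩
        have := hord (show (y, x) ∈ H ×ˢ Hᶜ from ⟨hy, hx⟩)
        simp only [orderedPairs, mem_ofPred_eq] at this ho
        exact lt_asymm this ho
      rw [this]
      simp
    have h4 : m.real (H ×ˢ Hᶜ) ≤ m.real (F ×ˢ Fᶜ) := by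
      have := measureReal_nonneg (μ := m) (s := Fᶜ ×ˢ F)
      linarith
    rw [Measure.real, Measure.real, ENNReal.toReal_le_toReal (measure_ne_top _ _)
      (measure_ne_top _ _), hm, Measure.restrict_apply' hW, Measure.restrict_apply' hW] at h4
    calc _ ≤ kMeasure K (H ×ˢ Hᶜ ∩ (near Ω ∩ farPairs ρ ∩ orderedPairs ν)) :=
          measure_mono fun p hp => ⟨hp.1.1, ⟨hp.1.2, hp.2⟩, hord hp.1.1⟩
      _ ≤ _ := h4
      _ ≤ _ := measure_mono (inter_subset_inter_right _
          (inter_subset_left.trans inter_subset_left))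
  have hU : (H ×ˢ Hᶜ) ∩ near Ω
      = ⋃ n : ℕ, (H ×ˢ Hᶜ) ∩ near Ω ∩ farPairs (1 / ((n : ℝ) + 1)) := by
    ext ⟨x, y⟩
    rw [mem_iUnion]
    constructor
    · intro h
      have hne : x - y ≠ 0 := by
        intro h0
        rw [sub_eq_zero] at h0
        exact h.1.2 (h0 ▸ h.1.1)
      obtain ⟨n, hn⟩ := exists_nat_one_div_lt (norm_pos_iff.2 hne)
      exact ⟨n, h, hn⟩
    · rintro ⟨n, h, -⟩
      exact h
  have hmono : Monotone fun n : ℕ => (H ×ˢ Hᶜ) ∩ near Ω ∩ farPairs (1 / ((n : ℝ) + 1)) := by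
    intro n n' hn p hp
    refine ⟨hp.1, show 1 / ((n' : ℝ) + 1) < ‖p.1 - p.2‖ from lt_of_le_of_lt ?_ hp.2⟩
    exact one_div_le_one_div_of_le (by positivity) (by exact_mod_cast Nat.succ_le_succ hn)
  rw [hU, hmono.measure_iUnion]
  exact iSup_le key

lemma measurableSet_halfSpace {H : Set Plane} (hH : IsHalfSpace H) : MeasurableSet H := by
  obtain ⟨ν, -, c, rfl⟩ := hH
  refine measurableSet_le ?_ measurable_const
  fun_prop

/-- Translates of a half-plane are nested, so one of gained and lost is empty, and the free bound on
their difference bounds their sum. -/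
lemma kPerimeter_halfSpace_lt_top (hs : s ∈ Ioo (0 : ℝ) 1) (hlam : 0 < lam)
    (hK : IsL2Kernel 2 s lam Lam K) {Ω H : Set Plane} (hΩ : MeasurableSet Ω)
    (hΩb : Bornology.IsBounded Ω) (hH : IsHalfSpace H) : kPerimeter K Ω H < ⊤ := by
  have hKm := hK.measurable hs hlam
  have hHm := measurableSet_halfSpace hH
  obtain ⟨r, hr, hsub⟩ := hΩb.subset_ball_lt 0 0
  refine (kPerimeter_mono_domain hKm hΩ measurableSet_ball hHm hsub).trans_lt
    ((kPerimeter_ball_le_of_translation hs hlam hK hHm (V := 3 * discArea * r) hr one_pos le_rfl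
      (by have := discArea_nonneg; positivity) fun h hh => ?_).trans_lt ENNReal.ofReal_lt_top)
  have hb := abs_gained_sub_lost_le hHm (z := 0) hr.le hh
  obtain ⟨ν, -, c, hHe⟩ := hH
  have : gained H h 0 r = ∅ ∨ lost H h 0 r = ∅ := by
    rcases le_total 0 (inner ℝ ν h) with hi | hi
    · right
      ext x
      simp only [lost, mem_inter_iff, mem_empty_iff_false, iff_false, hHe, mem_ofPred_eq, not_and,
        not_not, inner_sub_right]
      intros
      linarith
    · left
      ext x
      simp only [gained, mem_inter_iff, mem_empty_iff_false, iff_false, hHe, mem_ofPred_eq, not_and,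
        not_not, inner_sub_right]
      intros
      linarith
  have habs := abs_le.1 hb
  rcases this with h0 | h0 <;> rw [h0] at habs ⊢ <;>
    simp only [measureReal_empty] at habs ⊢ <;> linarith [habs.1, habs.2]

end HalfPlane

/-! ### Flows of test fields -/

section Flow

variable {Ω : Set Plane} {X : Plane × ℝ → Plane} {Ψ : ℝ → Plane → Plane}

lemma exists_lipschitzWith_field (hX : IsTestField Ω X) :
    ∃ C : ℝ≥0, ∀ t, LipschitzWith C fun x => X (x, t) := by
  obtain ⟨C, hC⟩ := ContDiff.lipschitzWith_of_hasCompactSupport hX.2.1 hX.1 (by norm_num)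
  refine ⟨C, fun t => ?_⟩
  refine LipschitzWith.of_dist_le_mul fun x y => ?_
  simpa [Prod.dist_eq] using hC.dist_le_mul (x, t) (y, t)

lemma flow_eq_of_eq (hX : IsTestField Ω X) (hΨ : IsIntegralFlow X Ψ) {f : ℝ → Plane}
    (hf : ∀ t, HasDerivAt f (X (f t, t)) t) {x : Plane} {t₀ : ℝ} (h : Ψ t₀ x = f t₀) :
    (fun t => Ψ t x) = f := by
  obtain ⟨C, hC⟩ := exists_lipschitzWith_field hX
  exact ODE_solution_unique_univ (v := fun t y => X (y, t)) (s := fun _ => univ)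
    (fun t => (hC t).lipschitzOnWith) (fun t => ⟨(hΨ x).2 t, trivial⟩)
    (fun t => ⟨hf t, trivial⟩) h

lemma flow_injective (hX : IsTestField Ω X) (hΨ : IsIntegralFlow X Ψ) (t : ℝ) :
    Function.Injective (Ψ t) := by
  intro x y h
  have := congrFun (flow_eq_of_eq hX hΨ (fun τ => (hΨ y).2 τ) h) 0
  simpa [(hΨ x).1, (hΨ y).1] using this

lemma flow_eq_self (hX : IsTestField Ω X) (hΨ : IsIntegralFlow X Ψ) {x : Plane} (hx : x ∉ Ω)
    (t : ℝ) : Ψ t x = x := by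
  refine congrFun (flow_eq_of_eq hX hΨ (f := fun _ => x) (x := x) (t₀ := 0)
    (fun τ => ?_) (hΨ x).1) t
  have h0 : X (x, τ) = 0 := by
    by_contra h
    exact hx (hX.2.2 (subset_tsupport _ h)).1
  rw [h0]
  exact hasDerivAt_const τ x

lemma flow_lipschitz_of_nonneg {C : ℝ≥0} (hC : ∀ t, LipschitzWith C fun x => X (x, t))
    (hΨ : IsIntegralFlow X Ψ) {t : ℝ} (ht : 0 ≤ t) :
    LipschitzWith (Real.toNNReal (Real.exp (C * t))) (Ψ t) := by
  refine LipschitzWith.of_dist_le_mul fun x y => ?_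
  have h := dist_le_of_trajectories_ODE (v := fun t y => X (y, t)) (a := 0) (b := t)
    (f := fun t => Ψ t x) (g := fun t => Ψ t y) (δ := dist x y) hC
    (fun τ _ => ((hΨ x).2 τ).continuousAt.continuousWithinAt)
    (fun τ _ => ((hΨ x).2 τ).hasDerivWithinAt)
    (fun τ _ => ((hΨ y).2 τ).continuousAt.continuousWithinAt)
    (fun τ _ => ((hΨ y).2 τ).hasDerivWithinAt)
    (by rw [(hΨ x).1, (hΨ y).1]) t ⟨ht, le_rfl⟩
  rw [Real.coe_toNNReal _ (Real.exp_pos _).le, mul_comm]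
  simpa using h

/-- Grönwall's inequality for `t ≥ 0`; for `t ≤ 0` the time-reversed flow belongs to the field
`-X(·, -t)`. -/
lemma exists_flow_lipschitz (hX : IsTestField Ω X) (hΨ : IsIntegralFlow X Ψ) (t : ℝ) :
    ∃ C : ℝ≥0, LipschitzWith C (Ψ t) := by
  obtain ⟨C, hC⟩ := exists_lipschitzWith_field hX
  rcases le_total 0 t with ht | ht
  · exact ⟨_, flow_lipschitz_of_nonneg hC hΨ ht⟩
  · have hrev : IsIntegralFlow (fun p => -X (p.1, -p.2)) fun τ => Ψ (-τ) := by
      refine fun x => ⟨by simpa using (hΨ x).1, fun τ => ?_⟩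
      have h := HasDerivAt.scomp τ ((hΨ x).2 (-τ)) (hasDerivAt_neg τ)
      rw [neg_one_smul] at h
      exact h
    have hC' : ∀ τ, LipschitzWith C fun x => -X (x, -τ) := fun τ => (hC (-τ)).neg
    have h := flow_lipschitz_of_nonneg (X := fun p => -X (p.1, -p.2)) hC' hrev
      (neg_nonneg.2 ht)
    rw [neg_neg] at h
    exact ⟨_, h⟩

/-- Lipschitz maps preserve Hausdorff null sets, and two-dimensional Hausdorff measure has the same
null sets as Lebesgue measure. This makes stability insensitive to null modifications of `E`. -/
lemma volume_image_eq_zero_of_lipschitz {f : Plane → Plane} {C : ℝ≥0} (hf : LipschitzWith C f)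
    {S : Set Plane} (hS : volume S = 0) : volume (f '' S) = 0 := by
  have hH : (Measure.hausdorffMeasure (Module.finrank ℝ Plane) : Measure Plane).IsAddHaarMeasure :=
    isAddHaarMeasure_hausdorffMeasure
  have h1 : (Measure.hausdorffMeasure (Module.finrank ℝ Plane) : Measure Plane) S = 0 :=
    Measure.absolutelyContinuous_isAddHaarMeasure _ volume hS
  have h2 := hf.hausdorffMeasure_image_le (d := (Module.finrank ℝ Plane : ℝ)) (by positivity) S
  rw [h1, mul_zero] at h2
  exact Measure.absolutelyContinuous_isAddHaarMeasure volume
    (Measure.hausdorffMeasure (Module.finrank ℝ Plane) : Measure Plane) (le_antisymm h2 zero_le)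

lemma image_ae_eq_of_lipschitz {f : Plane → Plane} {C : ℝ≥0} (hf : LipschitzWith C f)
    {S T : Set Plane} (h : S =ᵐ[volume] T) : (f '' S : Set Plane) =ᵐ[volume] (f '' T) := by
  have hsub : ∀ S T : Set Plane, f '' S \ f '' T ⊆ f '' (S \ T) := by
    rintro S T _ ⟨⟨x, hx, rfl⟩, hn⟩
    exact ⟨x, ⟨hx, fun hT => hn ⟨x, hT, rfl⟩⟩, rfl⟩
  rw [ae_eq_set] at h ⊢
  constructor
  · exact measure_mono_null (hsub S T) (volume_image_eq_zero_of_lipschitz hf h.1)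
  · exact measure_mono_null (hsub T S) (volume_image_eq_zero_of_lipschitz hf h.2)

lemma image_flow_sdiff (hX : IsTestField Ω X) (hΨ : IsIntegralFlow X Ψ) (t : ℝ) (S : Set Plane) :
    Ψ t '' S \ Ω = S \ Ω := by
  ext y
  constructor
  · rintro ⟨⟨x, hx, rfl⟩, hy⟩
    have h := flow_injective hX hΨ t (flow_eq_self hX hΨ hy t)
    rw [h] at hy ⊢
    exact ⟨hx, hy⟩
  · rintro ⟨hy, hyΩ⟩
    exact ⟨⟨y, hy, flow_eq_self hX hΨ hyΩ t⟩, hyΩ⟩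

lemma measurableSet_image_flow (hX : IsTestField Ω X) (hΨ : IsIntegralFlow X Ψ) (t : ℝ)
    {S : Set Plane} (hS : MeasurableSet S) : MeasurableSet (Ψ t '' S) := by
  obtain ⟨C, hC⟩ := exists_flow_lipschitz hX hΨ t
  exact hS.image_of_continuousOn_injOn hC.continuous.continuousOn (flow_injective hX hΨ t).injOn

end Flow

/-! ### The trivial sets and half-planes are stable -/

section Sufficiency

variable {s lam Lam : ℝ} {K : Plane → ℝ}

lemma kPerimeter_empty (Ω : Set Plane) : kPerimeter K Ω ∅ = 0 := by
  simp [kPerimeter, kInteraction]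

lemma kPerimeter_univ (Ω : Set Plane) : kPerimeter K Ω univ = 0 := by
  simp [kPerimeter, kInteraction]

lemma isStableInEveryCompact_of_kPerimeter_eq_zero {E : Set Plane}
    (h : ∀ Ω, kPerimeter K Ω E = 0) : IsStableInEveryCompact K E := by
  intro Ω _ _
  rw [IsStableSet, h]
  exact ⟨ENNReal.zero_lt_top, fun _ _ _ _ _ _ => ⟨1, one_pos, fun _ _ => ⟨zero_le, zero_le⟩⟩⟩

/-- The flow fixes every point outside `Ω`, so union and intersection are competitors in
`kPerimeter_halfSpace_le`; the term `ε t²` is not used. -/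
lemma isStableInEveryCompact_of_halfSpace (hs : s ∈ Ioo (0 : ℝ) 1) (hlam : 0 < lam)
    (hK : IsL2Kernel 2 s lam Lam K) {E H : Set Plane} (hH : IsHalfSpace H)
    (hEH : E =ᵐ[volume] H) : IsStableInEveryCompact K E := by
  intro Ω hΩo hΩb
  have hΩ := hΩo.measurableSet
  have hHm := measurableSet_halfSpace hH
  refine ⟨?_, fun X hX Ψ hΨ ε hε => ⟨1, one_pos, fun t _ => ?_⟩⟩
  · rw [kPerimeter_congr hEH]
    exact kPerimeter_halfSpace_lt_top hs hlam hK hΩ hΩb hH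
  · obtain ⟨C, hC⟩ := exists_flow_lipschitz hX hΨ t
    have hFm := measurableSet_image_flow hX hΨ t hHm
    have hFE := image_ae_eq_of_lipschitz hC hEH
    have hd := image_flow_sdiff hX hΨ t H
    rw [kPerimeter_congr hEH, kPerimeter_congr (hFE.union hEH), kPerimeter_congr (hFE.inter hEH)]
    constructor
    · refine le_add_right (kPerimeter_halfSpace_le hs hlam hK hΩ hΩb.measure_lt_top.ne
        (hFm.union hHm) hHm hH ?_)
      rw [union_sdiff_distrib, hd, union_self]
    · refine le_add_right (kPerimeter_halfSpace_le hs hlam hK hΩ hΩb.measure_lt_top.ne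
        (hFm.inter hHm) hHm hH ?_)
      rw [show (Ψ t '' H ∩ H) \ Ω = (Ψ t '' H \ Ω) ∩ (H \ Ω) by ext; simp; tauto, hd, inter_self]

end Sufficiency

/-! ### Realizing shears by test fields -/

section Perturbation

variable {V : Type*} [NormedAddCommGroup V] [NormedSpace ℝ V] [CompleteSpace V] [Nontrivial V]

/-- A small smooth perturbation of the identity is a diffeomorphism. -/
lemma exists_homeomorph_add_of_lipschitz {g : V → V} (hg : ContDiff ℝ 2 g) {c : ℝ≥0} (hc : c < 1)
    (hgl : LipschitzWith c g) :
    ∃ G : V ≃ₜ V, (∀ p, G p = p + g p) ∧ ContDiff ℝ 2 G.symm := by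
  have hap : ApproximatesLinearOn (fun p => p + g p)
      ((ContinuousLinearEquiv.refl ℝ V : V ≃L[ℝ] V) : V →L[ℝ] V) univ c := by
    intro x _ y _
    have h := hgl.norm_sub_le x y
    convert! h using 2
    simp
    abel
  have hN : Subsingleton V ∨ c < ‖((ContinuousLinearEquiv.refl ℝ V).symm : V →L[ℝ] V)‖₊⁻¹ := by
    right
    have : ‖((ContinuousLinearEquiv.refl ℝ V).symm : V →L[ℝ] V)‖₊ = 1 := by
      ext
      exact ContinuousLinearMap.norm_id
    rwa [this, inv_one]
  refine ⟨hap.toHomeomorph _ hN, fun _ => rfl, ?_⟩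
  have hu : ∀ a, IsUnit (1 - -fderiv ℝ g a) := fun a => by
    refine isUnit_one_sub_of_norm_lt_one ?_
    rw [norm_neg]
    exact (norm_fderiv_le_of_lipschitz ℝ hgl).trans_lt (by exact_mod_cast hc)
  refine Homeomorph.contDiff_symm _
    (f₀' := fun a => ContinuousLinearEquiv.unitsEquiv ℝ V (hu a).unit) (fun a => ?_)
    (contDiff_id.add hg)
  have h1 := (hasFDerivAt_id a).add ((hg.differentiable (by norm_num)) a).hasFDerivAt
  convert! h1 using 1
  ext v
  simp

end Perturbation

/-- A smooth time profile with slope one near the origin. -/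
lemma exists_time_profile : ∃ θ : ℝ → ℝ, ContDiff ℝ ∞ θ ∧ HasCompactSupport θ ∧
    tsupport θ ⊆ Ioo (-1 : ℝ) 1 ∧ ∀ t ∈ Ioo (-(1 / 3) : ℝ) (1 / 3), θ t = t := by
  let b : ContDiffBump (0 : ℝ) := ⟨1 / 3, 1 / 2, by norm_num, by norm_num⟩
  refine ⟨fun t => t * b t, contDiff_id.mul b.contDiff, b.hasCompactSupport.mul_left, ?_, ?_⟩
  · refine (tsupport_mul_subset_right (f := fun t : ℝ => t) (g := b)).trans ?_
    rw [b.tsupport_eq, Real.closedBall_eq_Icc]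
    intro t ht
    change t ∈ Icc (0 - 1 / 2 : ℝ) (0 + 1 / 2) at ht
    constructor <;> linarith [ht.1, ht.2]
  · intro t ht
    have : b t = 1 := b.one_of_mem_closedBall (by
      rw [mem_closedBall, Real.dist_eq, sub_zero]
      exact (abs_lt.2 ht).le)
    simp [this]

/-- The map which moves points in direction `e` with speed profile `φ`. -/
noncomputable def shear (φ : Plane → ℝ) (e : Plane) (a : ℝ) (x : Plane) : Plane :=
  x + (a * φ x) • e

/-- Up to reparametrization of time, the maps `shear φ e t` for small `t` are the integral flow of
a test field. -/
lemma exists_testField_flow {Ω : Set Plane} {φ : Plane → ℝ} (hφ : ContDiff ℝ ∞ φ)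
    (hφc : HasCompactSupport φ) (hφΩ : tsupport φ ⊆ Ω) (e : Plane) :
    ∃ κ : ℝ, 0 < κ ∧ ∃ X Ψ, IsTestField Ω X ∧ IsIntegralFlow X Ψ ∧
      ∀ t ∈ Ioo (-(1 / 3) : ℝ) (1 / 3), Ψ t = shear φ e (κ * t) ∧ Function.Surjective (Ψ t) := by
  obtain ⟨θ, hθ, hθc, hθs, hθ1⟩ := exists_time_profile
  have hgs : ContDiff ℝ ∞ fun p : Plane × ℝ => (((θ p.2 * φ p.1) • e, 0) : Plane × ℝ) := by
    refine ContDiff.prodMk ?_ contDiff_const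
    exact ((hθ.comp contDiff_snd).mul (hφ.comp contDiff_fst)).smul contDiff_const
  have hQ : IsCompact (tsupport φ ×ˢ tsupport θ) := hφc.prod hθc
  have hgc : HasCompactSupport fun p : Plane × ℝ => (((θ p.2 * φ p.1) • e, 0) : Plane × ℝ) := by
    refine HasCompactSupport.intro hQ fun p hp => ?_
    rw [mem_prod, not_and_or] at hp
    rcases hp with hp | hp <;> simp [image_eq_zero_of_notMem_tsupport hp]
  obtain ⟨M, hM⟩ := ContDiff.lipschitzWith_of_hasCompactSupport hgc hgs (by simp)
  -- With this speed the motion is a small perturbation of the identity of space-time, so its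
  -- inverse is jointly `C²` in position and time.
  set κ : ℝ≥0 := (2 * (M + 1))⁻¹ with hκ
  have hκ0 : 0 < κ := by positivity
  have hκM : κ * M < 1 := by
    rw [hκ, inv_mul_lt_iff₀ (by positivity), mul_one]
    calc M < M + 1 := lt_add_one M
      _ ≤ 2 * (M + 1) := le_mul_of_one_le_left zero_le one_le_two
  have hgκ : LipschitzWith (κ * M)
      fun p : Plane × ℝ => (κ : ℝ) • (((θ p.2 * φ p.1) • e, 0) : Plane × ℝ) := by
    refine LipschitzWith.of_dist_le_mul fun p q => ?_
    rw [dist_smul₀, NNReal.norm_eq, NNReal.coe_mul, mul_assoc]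
    gcongr
    exact hM.dist_le_mul p q
  obtain ⟨G, hG, hGs⟩ := exists_homeomorph_add_of_lipschitz
    (contDiff_infty.1 (hgs.const_smul (κ : ℝ)) 2) hκM hgκ
  have hG' : ∀ x t, G (x, t) = (shear φ e (κ * θ t) x, t) := by
    intro x t
    rw [hG]
    simp [shear, smul_smul, mul_assoc]
  have hGS : ∀ x t, G.symm (shear φ e (κ * θ t) x, t) = (x, t) := by
    intro x t
    rw [← hG', G.symm_apply_apply]
  have hid : ∀ x t, x ∉ Ω → shear φ e (κ * θ t) x = x := by
    intro x t hx
    simp [shear, image_eq_zero_of_notMem_tsupport fun h => hx (hφΩ h)]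
  -- A point carried out of `Ω` would land on a fixed point, against injectivity.
  have hinv : ∀ x t, x ∈ Ω → shear φ e (κ * θ t) x ∈ Ω := by
    intro x t hx
    by_contra h
    have h1 := hGS x t
    have h2 := hGS (shear φ e (κ * θ t) x) t
    rw [hid _ t h, h1] at h2
    have h3 : x = shear φ e (κ * θ t) x := congrArg Prod.fst h2
    rw [← h3] at h
    exact h hx
  have hθ' : ContDiff ℝ ∞ (deriv θ) := (contDiff_infty_iff_deriv.1 hθ).2
  -- The velocity of the shearing motion, read at the current position by going back through
  -- `G.symm`.
  set X : Plane × ℝ → Plane := fun p => (κ * deriv θ p.2 * φ (G.symm p).1) • e with hX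
  have hQ' : IsCompact (G '' (tsupport φ ×ˢ tsupport (deriv θ))) :=
    (hφc.prod hθc.deriv).image G.continuous
  have hXs : ∀ p ∉ G '' (tsupport φ ×ˢ tsupport (deriv θ)), X p = 0 := by
    intro p hp
    have hp2 : (G.symm p).2 = p.2 := by
      conv_rhs => rw [← G.apply_symm_apply p]
      rw [← Prod.mk.eta (p := G.symm p), hG']
    have : G.symm p ∉ tsupport φ ×ˢ tsupport (deriv θ) := fun h =>
      hp ⟨G.symm p, h, G.apply_symm_apply p⟩
    rw [mem_prod, not_and_or, hp2] at this
    rcases this with h | h <;> simp [hX, image_eq_zero_of_notMem_tsupport h]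
  refine ⟨κ, by exact_mod_cast hκ0, X, fun t => shear φ e (κ * θ t), ⟨?_, ?_, ?_⟩, ?_, ?_⟩
  · suffices h : ContDiff ℝ 2 fun p : Plane × ℝ => κ * deriv θ p.2 * φ (G.symm p).1 from
      h.smul contDiff_const
    refine ContDiff.mul (contDiff_const.mul ?_) ?_
    · exact (contDiff_infty.1 hθ' 2).comp contDiff_snd
    · exact (contDiff_infty.1 hφ 2).comp (contDiff_fst.comp hGs)
  · exact HasCompactSupport.intro hQ' hXs
  · have h1 : tsupport X ⊆ G '' (tsupport φ ×ˢ tsupport (deriv θ)) :=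
      closure_minimal (fun p hp => by_contra fun h => hp (hXs p h)) hQ'.isClosed
    refine h1.trans ?_
    rintro _ ⟨⟨x, t⟩, ⟨hx, ht⟩, rfl⟩
    rw [hG']
    exact ⟨hinv x t (hφΩ hx), hθs (tsupport_deriv_subset ht)⟩
  · refine fun x => ⟨?_, fun t => ?_⟩
    · have : θ 0 = 0 := hθ1 0 (by norm_num)
      simp [shear, this]
    · have h1 : HasDerivAt (fun τ => x + (κ * θ τ * φ x) • e)
          ((κ * deriv θ t * φ x) • e) t := by
        have hd := ((hθ.differentiable (by simp)) t).hasDerivAt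
        exact (((hd.const_mul (κ : ℝ)).mul_const (φ x)).smul_const e).const_add x
      simp only [hX, hGS]
      exact h1
  · intro t ht
    refine ⟨by simp only [hθ1 t ht], fun y => ⟨(G.symm (y, t)).1, ?_⟩⟩
    have h1 := G.apply_symm_apply (y, t)
    rw [← Prod.mk.eta (p := G.symm (y, t)), hG'] at h1
    have h2 := congrArg Prod.snd h1
    have h3 := congrArg Prod.fst h1
    simp only at h2 h3
    rw [h2] at h3
    exact h3

/-- A single bump is rescaled, so `l` does not depend on `z` or `R`. The square of the Lipschitz
constant `l / R` produces the factor `1 / R²` in the stability estimate. -/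
lemma exists_cutoff : ∃ l : ℝ≥0, ∀ (z : Plane) (R : ℝ≥0), 0 < R → ∃ φ : Plane → ℝ,
    ContDiff ℝ ∞ φ ∧ HasCompactSupport φ ∧ tsupport φ ⊆ ball z (3 * R) ∧
      (∀ x ∈ ball z R, φ x = 1) ∧ LipschitzWith (l / R) φ := by
  let b : ContDiffBump (0 : Plane) := ⟨1, 2, by norm_num, by norm_num⟩
  obtain ⟨l, hl⟩ := ContDiff.lipschitzWith_of_hasCompactSupport b.hasCompactSupport
    (b.contDiff (n := ⊤)) (by simp)
  refine ⟨l, fun z R hR => ?_⟩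
  have hR' : (0 : ℝ) < R := by exact_mod_cast hR
  have hsub : tsupport (fun x => b ((R : ℝ)⁻¹ • (x - z))) ⊆ closedBall z (2 * R) := by
    refine closure_minimal (fun x hx => ?_) isClosed_closedBall
    have h1 : (R : ℝ)⁻¹ • (x - z) ∈ Function.support b := hx
    rw [b.support_eq] at h1
    change (R : ℝ)⁻¹ • (x - z) ∈ ball (0 : Plane) 2 at h1
    rw [mem_ball_zero_iff, norm_smul, norm_inv, Real.norm_of_nonneg hR'.le,
      inv_mul_lt_iff₀ hR'] at h1
    rw [mem_closedBall_iff_norm]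
    linarith
  refine ⟨fun x => b ((R : ℝ)⁻¹ • (x - z)), ?_, ?_, ?_, ?_, ?_⟩
  · exact b.contDiff.comp ((contDiff_id.sub contDiff_const).const_smul _)
  · exact (isCompact_closedBall z (2 * R)).of_isClosed_subset (isClosed_tsupport _) hsub
  · exact hsub.trans (closedBall_subset_ball (by linarith))
  · intro x hx
    refine b.one_of_mem_closedBall ?_
    change (R : ℝ)⁻¹ • (x - z) ∈ closedBall (0 : Plane) 1
    rw [mem_closedBall_zero_iff, norm_smul, norm_inv, Real.norm_of_nonneg hR'.le,
      inv_mul_le_iff₀ hR', mul_one]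
    exact (mem_ball_iff_norm.1 hx).le
  · refine LipschitzWith.of_dist_le_mul fun x y => ?_
    refine (hl.dist_le_mul _ _).trans_eq ?_
    rw [dist_smul₀, dist_sub_right, norm_inv, Real.norm_of_nonneg hR'.le]
    push_cast
    ring

/-! ### Second variation of the interaction under shears -/

section Shear

variable {φ : Plane → ℝ} {e : Plane} {l : ℝ≥0} {a : ℝ}

lemma shear_sub (x y : Plane) :
    shear φ e a x - shear φ e a y = (x - y) + (a * (φ x - φ y)) • e := by
  simp only [shear]
  module

lemma shear_injective (he : ‖e‖ = 1) (hl : LipschitzWith l φ) (ha : |a| * l ≤ 1 / 2) :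
    Function.Injective (shear φ e a) := by
  intro x y h
  rw [← sub_eq_zero, shear_sub] at h
  have h1 : ‖x - y‖ = |a| * |φ x - φ y| := by
    rw [eq_neg_of_add_eq_zero_left h, norm_neg, norm_smul, he, mul_one, Real.norm_eq_abs, abs_mul]
  have h2 : |φ x - φ y| ≤ l * ‖x - y‖ := hl.norm_sub_le x y
  have h3 : ‖x - y‖ ≤ 1 / 2 * ‖x - y‖ := by
    calc ‖x - y‖ = |a| * |φ x - φ y| := h1
      _ ≤ |a| * (l * ‖x - y‖) := by gcongr
      _ = |a| * l * ‖x - y‖ := by ring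
      _ ≤ _ := by gcongr
  rw [← sub_eq_zero, ← norm_eq_zero]
  linarith [norm_nonneg (x - y)]

/-- The Jacobian of `shear φ e a`. -/
noncomputable def shearJacobian (φ : Plane → ℝ) (e : Plane) (a : ℝ) (x : Plane) : ℝ :=
  1 + a * fderiv ℝ φ x e

lemma abs_fderiv_apply_le (he : ‖e‖ = 1) (hl : LipschitzWith l φ) (x : Plane) :
    |fderiv ℝ φ x e| ≤ l := by
  have := (fderiv ℝ φ x).le_opNorm e
  rw [he, mul_one] at this
  exact this.trans (norm_fderiv_le_of_lipschitz ℝ hl)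

lemma shearJacobian_pos (he : ‖e‖ = 1) (hl : LipschitzWith l φ) (ha : |a| * l ≤ 1 / 2)
    (x : Plane) : 0 < shearJacobian φ e a x := by
  have h1 : |a * fderiv ℝ φ x e| ≤ 1 / 2 := by
    rw [abs_mul]
    refine le_trans ?_ ha
    gcongr
    exact abs_fderiv_apply_le he hl x
  have := neg_abs_le (a * fderiv ℝ φ x e)
  rw [shearJacobian]
  linarith

lemma measurable_shearJacobian : Measurable (shearJacobian φ e a) :=
  measurable_const.add (measurable_const.mul (measurable_fderiv_apply_const ℝ φ e))

/-- The derivative of a shear is a transvection, so the Jacobian is exactly affine in `a`, as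
`IsL2Kernel.second_variation_le` requires. -/
lemma setLIntegral_image_shear (hφ : ContDiff ℝ ∞ φ) (he : ‖e‖ = 1) (hl : LipschitzWith l φ)
    (ha : |a| * l ≤ 1 / 2) {A : Set Plane} (hA : MeasurableSet A) (g : Plane → ENNReal) :
    ∫⁻ x in shear φ e a '' A, g x
      = ∫⁻ x in A, ENNReal.ofReal (shearJacobian φ e a x) * g (shear φ e a x) := by
  have hd : ∀ x ∈ A, HasFDerivWithinAt (shear φ e a)
      (ContinuousLinearMap.id ℝ Plane + (a • fderiv ℝ φ x).smulRight e) A x := by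
    intro x _
    have h := ((hφ.differentiable (by simp)) x).hasFDerivAt
    exact ((hasFDerivAt_id x).add ((h.const_mul a).smul_const e)).hasFDerivWithinAt
  rw [lintegral_image_eq_lintegral_abs_det_fderiv_mul volume hA hd
    (shear_injective he hl ha).injOn]
  refine lintegral_congr fun x => ?_
  have hdet : (ContinuousLinearMap.id ℝ Plane + (a • fderiv ℝ φ x).smulRight e).det
      = shearJacobian φ e a x := by
    have : ((ContinuousLinearMap.id ℝ Plane + (a • fderiv ℝ φ x).smulRight e : Plane →L[ℝ] Plane) :
        Plane →ₗ[ℝ] Plane)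
        = LinearMap.transvection ((a • fderiv ℝ φ x : Plane →L[ℝ] ℝ) : Plane →ₗ[ℝ] ℝ) e := by
      ext v
      simp [LinearMap.transvection]
    rw [ContinuousLinearMap.det, this, LinearMap.transvection.det]
    simp [shearJacobian]
  rw [hdet, abs_of_pos (shearJacobian_pos he hl ha x)]

lemma continuous_shear (hl : LipschitzWith l φ) : Continuous (shear φ e a) :=
  continuous_id.add ((continuous_const.mul hl.continuous).smul continuous_const)

variable {s lam Lam : ℝ} {K : Plane → ℝ}

lemma kInteraction_image_shear (hφ : ContDiff ℝ ∞ φ) (he : ‖e‖ = 1)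
    (hl : LipschitzWith l φ) (ha : |a| * l ≤ 1 / 2) {A B : Set Plane} (hA : MeasurableSet A)
    (hB : MeasurableSet B) :
    kInteraction K (shear φ e a '' A) (shear φ e a '' B)
      = ∫⁻ x in A, ∫⁻ y in B, ENNReal.ofReal (K ((x - y) + (a * (φ x - φ y)) • e)
          * (shearJacobian φ e a x * shearJacobian φ e a y)) := by
  rw [kInteraction, setLIntegral_image_shear hφ he hl ha hA]
  refine lintegral_congr fun x => ?_
  rw [setLIntegral_image_shear hφ he hl ha hB, ← lintegral_const_mul' _ _ ENNReal.ofReal_ne_top]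
  refine lintegral_congr fun y => ?_
  have hx := (shearJacobian_pos he hl ha x).le
  have hy := (shearJacobian_pos he hl ha y).le
  rw [shear_sub, ← mul_assoc, ← ENNReal.ofReal_mul hx, mul_comm,
    ENNReal.ofReal_mul' (mul_nonneg hx hy)]

lemma measurable_shear_integrand (hK : Measurable K) (hl : LipschitzWith l φ) :
    Measurable fun p : Plane × Plane => ENNReal.ofReal
      (K ((p.1 - p.2) + (a * (φ p.1 - φ p.2)) • e)
        * (shearJacobian φ e a p.1 * shearJacobian φ e a p.2)) := by
  have hφ : Measurable φ := hl.continuous.measurable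
  refine Measurable.ennreal_ofReal (Measurable.mul (hK.comp ?_) ?_)
  · refine (measurable_fst.sub measurable_snd).add (Measurable.smul_const ?_ e)
    exact measurable_const.mul ((hφ.comp measurable_fst).sub (hφ.comp measurable_snd))
  · exact (measurable_shearJacobian.comp measurable_fst).mul
      (measurable_shearJacobian.comp measurable_snd)

lemma shear_integrand_add_le (hs : s ∈ Ioo (0 : ℝ) 1) (hlam : 0 < lam)
    (hK : IsL2Kernel 2 s lam Lam K) (he : ‖e‖ = 1)
    (hl : LipschitzWith l φ) (ha : |a| * l ≤ 1 / 2) {x y : Plane} (hxy : y ≠ x) :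
    ENNReal.ofReal (K ((x - y) + (a * (φ x - φ y)) • e)
        * (shearJacobian φ e a x * shearJacobian φ e a y))
      + ENNReal.ofReal (K ((x - y) + (-a * (φ x - φ y)) • e)
        * (shearJacobian φ e (-a) x * shearJacobian φ e (-a) y))
      ≤ ENNReal.ofReal (2 + 146 * (Lam / lam) * l ^ 2 * a ^ 2) * ENNReal.ofReal (K (x - y)) := by
  have ha' : |-a| * l ≤ 1 / 2 := by rwa [abs_neg]
  have hL := hK.Lam_pos hlam
  have hz : x - y ≠ 0 := sub_ne_zero.2 hxy.symm
  have hτ : |φ x - φ y| ≤ l * ‖x - y‖ := hl.norm_sub_le x y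
  have h := hK.second_variation_le hs hlam he hz hτ (abs_fderiv_apply_le he hl x)
    (abs_fderiv_apply_le he hl y) ha
  have hJ := mul_nonneg (shearJacobian_pos he hl ha x).le (shearJacobian_pos he hl ha y).le
  have hJ' := mul_nonneg (shearJacobian_pos he hl ha' x).le (shearJacobian_pos he hl ha' y).le
  have hsm : |a * (φ x - φ y)| ≤ ‖x - y‖ / 2 := by
    rw [abs_mul]
    calc |a| * |φ x - φ y| ≤ |a| * (l * ‖x - y‖) := by gcongr
      _ = |a| * l * ‖x - y‖ := by ring
      _ ≤ 1 / 2 * ‖x - y‖ := by gcongr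
      _ = _ := by ring
  have k1 := (hK.pos hlam (IsL2Kernel.half_ne_zero hz he hsm)).le
  have k2 := (hK.pos hlam (IsL2Kernel.half_ne_zero hz he
    (b := -(a * (φ x - φ y))) (by rwa [abs_neg]))).le
  rw [neg_mul, ← ENNReal.ofReal_mul (by positivity),
    ← ENNReal.ofReal_add (mul_nonneg k1 hJ) (mul_nonneg k2 hJ')]
  refine ENNReal.ofReal_le_ofReal (le_trans (le_of_eq ?_) h)
  rw [shearJacobian, shearJacobian, shearJacobian, shearJacobian, neg_mul, neg_mul,
    ← sub_eq_add_neg, ← sub_eq_add_neg]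

lemma lintegral_lintegral_add_le {F G H : Plane → Plane → ENNReal} {c : ENNReal} (hc : c ≠ ⊤)
    (hF : Measurable (Function.uncurry F)) (h : ∀ x y, y ≠ x → F x y + G x y ≤ c * H x y)
    (A B : Set Plane) :
    (∫⁻ x in A, ∫⁻ y in B, F x y) + ∫⁻ x in A, ∫⁻ y in B, G x y
      ≤ c * ∫⁻ x in A, ∫⁻ y in B, H x y := by
  have hF1 : Measurable fun x => ∫⁻ y in B, F x y := hF.lintegral_prod_right'
  rw [← lintegral_add_left hF1, ← lintegral_const_mul' _ _ hc]
  refine lintegral_mono fun x => ?_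
  have hFx : Measurable (F x) := hF.comp measurable_prodMk_left
  rw [← lintegral_add_left hFx, ← lintegral_const_mul' _ _ hc]
  refine lintegral_mono_ae ?_
  have hne : ∀ᵐ y ∂(volume : Measure Plane).restrict B, y ≠ x :=
    ae_restrict_of_ae (Measure.ae_ne volume x)
  filter_upwards [hne] with y hy using h x y hy

/-- The second variation of the interaction energy along opposite shears. -/
lemma kInteraction_image_shear_add_le (hs : s ∈ Ioo (0 : ℝ) 1) (hlam : 0 < lam)
    (hK : IsL2Kernel 2 s lam Lam K) (hφ : ContDiff ℝ ∞ φ) (he : ‖e‖ = 1)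
    (hl : LipschitzWith l φ) (ha : |a| * l ≤ 1 / 2) {A B : Set Plane} (hA : MeasurableSet A)
    (hB : MeasurableSet B) :
    kInteraction K (shear φ e a '' A) (shear φ e a '' B)
      + kInteraction K (shear φ e (-a) '' A) (shear φ e (-a) '' B)
      ≤ ENNReal.ofReal (2 + 146 * (Lam / lam) * l ^ 2 * a ^ 2) * kInteraction K A B := by
  have hKm := hK.measurable hs hlam
  have ha' : |-a| * l ≤ 1 / 2 := by rwa [abs_neg]
  rw [kInteraction_image_shear hφ he hl ha hA hB, kInteraction_image_shear hφ he hl ha' hA hB,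
    kInteraction]
  exact lintegral_lintegral_add_le
    (F := fun x y => ENNReal.ofReal (K ((x - y) + (a * (φ x - φ y)) • e)
      * (shearJacobian φ e a x * shearJacobian φ e a y)))
    ENNReal.ofReal_ne_top (measurable_shear_integrand hKm hl)
    (fun x y hxy => shear_integrand_add_le hs hlam hK he hl ha hxy) A B

end Shear

/-! ### Consequences of stability -/

section SecondVariation

variable {s lam Lam : ℝ} {K : Plane → ℝ} {φ : Plane → ℝ} {e : Plane} {l : ℝ≥0}

lemma image_eq_self_of_eq_outside {S : Plane → Plane} (hS : Function.Bijective S) {Ω : Set Plane}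
    (hΩ : ∀ x ∉ Ω, S x = x) : S '' Ω = Ω := by
  have h : S '' Ωᶜ = Ωᶜ := by
    ext x
    constructor
    · rintro ⟨y, hy, rfl⟩
      rwa [hΩ y hy]
    · exact fun hx => ⟨x, hx, hΩ x hx⟩
  rw [image_compl_eq hS] at h
  exact compl_injective h

lemma kPerimeter_image {S : Plane → Plane} (hS : Function.Bijective S) {Ω : Set Plane}
    (hΩ : ∀ x ∉ Ω, S x = x) (E : Set Plane) :
    kPerimeter K Ω (S '' E) = kInteraction K (S '' (E ∩ Ω)) (S '' (Eᶜ ∩ Ω))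
      + kInteraction K (S '' (E ∩ Ω)) (S '' (Eᶜ \ Ω))
      + kInteraction K (S '' (E \ Ω)) (S '' (Eᶜ ∩ Ω)) := by
  rw [kPerimeter, image_inter hS.1, image_inter hS.1, image_sdiff hS.1, image_sdiff hS.1,
    image_compl_eq hS, image_eq_self_of_eq_outside hS hΩ]

lemma kPerimeter_image_shear_add_le (hs : s ∈ Ioo (0 : ℝ) 1) (hlam : 0 < lam)
    (hK : IsL2Kernel 2 s lam Lam K) (hφ : ContDiff ℝ ∞ φ) (he : ‖e‖ = 1)
    (hl : LipschitzWith l φ) {a : ℝ} (ha : |a| * l ≤ 1 / 2)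
    (h1 : Function.Surjective (shear φ e a)) (h2 : Function.Surjective (shear φ e (-a)))
    {Ω E : Set Plane} (hΩ : MeasurableSet Ω) (hφΩ : ∀ x ∉ Ω, φ x = 0) (hE : MeasurableSet E) :
    kPerimeter K Ω (shear φ e a '' E) + kPerimeter K Ω (shear φ e (-a) '' E)
      ≤ ENNReal.ofReal (2 + 146 * (Lam / lam) * l ^ 2 * a ^ 2) * kPerimeter K Ω E := by
  have ha' : |-a| * l ≤ 1 / 2 := by rwa [abs_neg]
  have hid : ∀ b, ∀ x ∉ Ω, shear φ e b x = x := fun b x hx => by simp [shear, hφΩ x hx]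
  rw [kPerimeter_image ⟨shear_injective he hl ha, h1⟩ (hid a),
    kPerimeter_image ⟨shear_injective he hl ha', h2⟩ (hid (-a)), kPerimeter, mul_add, mul_add]
  have i1 := kInteraction_image_shear_add_le hs hlam hK hφ he hl ha (hE.inter hΩ)
    (hE.compl.inter hΩ)
  have i2 := kInteraction_image_shear_add_le hs hlam hK hφ he hl ha (hE.inter hΩ)
    (hE.compl.diff hΩ)
  have i3 := kInteraction_image_shear_add_le hs hlam hK hφ he hl ha (hE.diff hΩ)
    (hE.compl.inter hΩ)
  refine le_trans (le_of_eq ?_) (add_le_add (add_le_add i1 i2) i3)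
  ring

/-- The four stability inequalities give `4P ≤ U + N + U' + N' + 4ε`. The two submodularity
inequalities and `h4` bound the right side by `(4 + c)P - I + 4ε`; finiteness of `P` permits
cancelling. -/
lemma excess_le {P U N F I U' N' F' c ε : ENNReal} (hP : P ≠ ⊤) (h1 : P ≤ U + ε) (h2 : P ≤ N + ε)
    (h3 : U + N + I ≤ F + P) (h1' : P ≤ U' + ε) (h2' : P ≤ N' + ε) (h3' : U' + N' ≤ F' + P)
    (h4 : F + F' ≤ (2 + c) * P) : I ≤ c * P + 4 * ε := by
  have hP4 : P + P + (P + P) ≠ ⊤ := by simp [hP]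
  refine (ENNReal.add_le_add_iff_left hP4).1 ?_
  calc P + P + (P + P) + I ≤ (U + ε) + (N + ε) + ((U' + ε) + (N' + ε)) + I := by gcongr
    _ = (U + N + I) + (U' + N') + 4 * ε := by ring
    _ ≤ (F + P) + (F' + P) + 4 * ε := by gcongr
    _ = (F + F') + (P + P) + 4 * ε := by ring
    _ ≤ (2 + c) * P + (P + P) + 4 * ε := by gcongr
    _ = P + P + (P + P) + (c * P + 4 * ε) := by ring

/-- Stability and the second variation bound control the interaction between what a shear adds to
a stable set and what it removes from it. -/
lemma IsStableSet.excess_le (hs : s ∈ Ioo (0 : ℝ) 1) (hlam : 0 < lam)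
    (hK : IsL2Kernel 2 s lam Lam K) (hφ : ContDiff ℝ ∞ φ) (hφc : HasCompactSupport φ)
    (he : ‖e‖ = 1) (hl : LipschitzWith l φ) {Ω E : Set Plane} (hΩ : MeasurableSet Ω)
    (hφΩ : tsupport φ ⊆ Ω) (hE : MeasurableSet E) (hst : IsStableSet K Ω E) {η : ℝ} (hη : 0 < η) :
    ∃ t₀ : ℝ, 0 < t₀ ∧ ∀ t, |t| < t₀ →
      kMeasure K (((shear φ e t '' E \ E) ×ˢ (E \ shear φ e t '' E)) ∩ near Ω)
        ≤ ENNReal.ofReal ((146 * (Lam / lam) * l ^ 2 * (kPerimeter K Ω E).toReal + η) * t ^ 2) := by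
  have hKm := hK.measurable hs hlam
  have hL := hK.Lam_pos hlam
  obtain ⟨κ, hκ, X, Ψ, hX, hΨ, hΨs⟩ := exists_testField_flow hφ hφc hφΩ e
  obtain ⟨hfin, hstab⟩ := hst
  -- The shear by `t` is the flow at time `t / κ`, and four stability inequalities are added: the
  -- errors sum to `η t²`.
  obtain ⟨t₁, ht₁, hst⟩ := hstab X hX Ψ hΨ (η * κ ^ 2 / 4) (by positivity)
  have hφ0 : ∀ x ∉ Ω, φ x = 0 := fun x hx =>
    image_eq_zero_of_notMem_tsupport fun h => hx (hφΩ h)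
  -- The first entry keeps `t / κ` where stability applies and the time profile is linear; the
  -- second ensures `|t| l ≤ 1/2`.
  refine ⟨min (κ * min t₁ (1 / 3)) (1 / (2 * (l + 1))), by positivity, fun t ht => ?_⟩
  rw [lt_min_iff] at ht
  have hτ : |t / κ| < min t₁ (1 / 3) := by
    rw [abs_div, abs_of_pos hκ, div_lt_iff₀ hκ, mul_comm]
    exact ht.1
  rw [lt_min_iff] at hτ
  have htl : |t| * l ≤ 1 / 2 := by
    have h := ht.2
    rw [lt_div_iff₀ (by positivity)] at h
    nlinarith [abs_nonneg t, l.2]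
  have hτn : |-(t / κ)| < t₁ ∧ |-(t / κ)| < 1 / 3 := by rwa [abs_neg]
  obtain ⟨e1, hsu1⟩ := hΨs (t / κ) (abs_lt.1 hτ.2)
  obtain ⟨e2, hsu2⟩ := hΨs (-(t / κ)) (abs_lt.1 hτn.2)
  obtain ⟨s1, s2⟩ := hst (t / κ) (abs_lt.1 hτ.1)
  obtain ⟨s1', s2'⟩ := hst (-(t / κ)) (abs_lt.1 hτn.1)
  have k1 : κ * (t / κ) = t := by field_simp
  have k2 : κ * -(t / κ) = -t := by field_simp
  rw [k1] at e1
  rw [k2] at e2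
  rw [e1] at s1 s2 hsu1
  rw [e2] at s1' s2' hsu2
  rw [neg_sq] at s1' s2'
  have htl' : |-t| * l ≤ 1 / 2 := by rwa [abs_neg]
  have hm1 : MeasurableSet (shear φ e t '' E) := hE.image_of_continuousOn_injOn
    (continuous_shear hl).continuousOn (shear_injective he hl htl).injOn
  have hm2 : MeasurableSet (shear φ e (-t) '' E) := hE.image_of_continuousOn_injOn
    (continuous_shear hl).continuousOn (shear_injective he hl htl').injOn
  have h3 := kPerimeter_union_add_inter_le hKm hΩ hE hm1
  have h3' := le_self_add.trans (kPerimeter_union_add_inter_le hKm hΩ hE hm2)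
  have h4 := kPerimeter_image_shear_add_le hs hlam hK hφ he hl htl hsu1 hsu2 hΩ hφ0 hE
  have hc : ENNReal.ofReal (2 + 146 * (Lam / lam) * l ^ 2 * t ^ 2)
      = 2 + ENNReal.ofReal (146 * (Lam / lam) * l ^ 2 * t ^ 2) := by
    rw [ENNReal.ofReal_add (by norm_num) (by positivity)]
    simp
  rw [hc] at h4
  refine (_root_.excess_le hfin.ne s1 s2 h3 s1' s2' h3' h4).trans (le_of_eq ?_)
  rw [show (4 : ENNReal) = ENNReal.ofReal 4 by simp, ← ENNReal.ofReal_mul (by norm_num)]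
  conv_lhs => rw [← ENNReal.ofReal_toReal hfin.ne]
  rw [← ENNReal.ofReal_mul (by positivity), ← ENNReal.ofReal_add (by positivity) (by positivity)]
  congr 1
  field_simp

lemma kMeasure_prod_ge (hs : s ∈ Ioo (0 : ℝ) 1) (hlam : 0 < lam)
    (hK : IsL2Kernel 2 s lam Lam K) {A B : Set Plane} (hA : MeasurableSet A)
    (hB : MeasurableSet B) (hAB : Disjoint A B) {z : Plane} {r : ℝ}
    (hAr : A ⊆ ball z r) (hBr : B ⊆ ball z r) :
    ENNReal.ofReal (lam / (2 * r) ^ (2 + s)) * volume B * volume A ≤ kMeasure K (A ×ˢ B) := by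
  rw [← kInteraction_eq (hK.measurable hs hlam) hA hB, kInteraction,
    ← setLIntegral_const A]
  refine setLIntegral_mono' hA fun x hx => ?_
  rw [← setLIntegral_const B]
  refine setLIntegral_mono' hB fun y hy => ?_
  have hne : x - y ≠ 0 := by
    intro h
    rw [sub_eq_zero] at h
    exact Set.disjoint_left.1 hAB hx (h ▸ hy)
  have hlt : ‖x - y‖ ≤ 2 * r := by
    have h1 := mem_ball.1 (hAr hx)
    have h2 := mem_ball.1 (hBr hy)
    rw [← dist_eq_norm]
    linarith [dist_triangle_right x y z]
  refine ENNReal.ofReal_le_ofReal (le_trans ?_ (hK.lower _ hne))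
  have hpos := norm_pos_iff.2 hne
  push_cast
  have h0 : 0 < ‖x - y‖ ^ (2 + s) := Real.rpow_pos_of_pos hpos _
  gcongr
  linarith [hs.1]

/-- In a stable set, the measures of what is gained and of what is lost under a small translation
cannot both be large. -/
lemma exists_gained_mul_lost_le (hs : s ∈ Ioo (0 : ℝ) 1) (hlam : 0 < lam)
    (hK : IsL2Kernel 2 s lam Lam K) : ∃ C : ℝ, 0 < C ∧ ∀ {E : Set Plane}, MeasurableSet E →
    ∀ {z : Plane} {R r : ℝ}, 0 < r → 2 * r ≤ R → IsStableSet K (ball z (3 * R)) E →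
    ∀ {e : Plane}, ‖e‖ = 1 → ∀ {η : ℝ}, 0 < η → ∃ t₀ : ℝ, 0 < t₀ ∧ ∀ t, |t| < t₀ →
      volume.real (gained E (t • e) z r) * volume.real (lost E (t • e) z r)
        ≤ C * r ^ (2 + s) * ((kPerimeter K (ball z (3 * R)) E).toReal / R ^ 2 + η) * t ^ 2 := by
  obtain ⟨l, hcut⟩ := exists_cutoff
  have hL := hK.Lam_pos hlam
  refine ⟨(2 : ℝ) ^ (2 + s) / lam * (146 * (Lam / lam) * l ^ 2 + 1), by positivity, ?_⟩
  intro E hE z R r hr hrR hst e he η hη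
  have hR : 0 < R := by linarith
  lift R to ℝ≥0 using hR.le
  obtain ⟨φ, hφ, hφc, hφs, hφ1, hφl⟩ := hcut z R (by exact_mod_cast hR)
  obtain ⟨t₁, ht₁, hb⟩ := hst.excess_le hs hlam hK hφ hφc he hφl measurableSet_ball hφs hE hη
  have hq : ((l / R : ℝ≥0) : ℝ) = l / R := NNReal.coe_div l R
  simp only [hq] at hb
  refine ⟨min (min t₁ r) (1 / (2 * ((l : ℝ) / R + 1))), by positivity, fun t ht => ?_⟩
  rw [lt_min_iff, lt_min_iff] at ht
  have htl : |t| * (l / R : ℝ≥0) ≤ 1 / 2 := by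
    rw [hq]
    have h := ht.2
    have hlR : 0 ≤ (l / R : ℝ) := by positivity
    rw [lt_div_iff₀ (by positivity)] at h
    nlinarith [abs_nonneg t]
  have hinj := shear_injective he hφl htl
  -- Since `|t| < r` and `2r ≤ R`, the point `x - t e` lies where `φ = 1`: on the small ball the
  -- shear acts as a translation.
  have hmem : ∀ x ∈ ball z r, (x ∈ shear φ e t '' E ↔ x - t • e ∈ E) := by
    intro x hx
    have h1 : φ (x - t • e) = 1 := by
      refine hφ1 _ ?_
      rw [mem_ball_iff_norm] at hx ⊢
      calc ‖x - t • e - z‖ = ‖(x - z) - t • e‖ := by congr 1; abel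
        _ ≤ ‖x - z‖ + ‖t • e‖ := norm_sub_le _ _
        _ < r + r := by
          rw [norm_smul, he, mul_one, Real.norm_eq_abs]
          exact add_lt_add hx ht.1.2
        _ ≤ (R : ℝ) := by linarith
    have h2 : shear φ e t (x - t • e) = x := by simp [shear, h1]
    constructor
    · rintro ⟨y, hy, hyx⟩
      rw [← hinj (hyx.trans h2.symm)]
      exact hy
    · exact fun h => ⟨_, h, h2⟩
  have hsub : gained E (t • e) z r ×ˢ lost E (t • e) z r
      ⊆ ((shear φ e t '' E \ E) ×ˢ (E \ shear φ e t '' E)) ∩ near (ball z (3 * R)) := by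
    rintro ⟨x, y⟩ ⟨⟨hx, hx1, hx2⟩, ⟨hy, hy1, hy2⟩⟩
    refine ⟨⟨⟨(hmem x hx).2 hx1, hx2⟩, hy1, fun h => hy2 ((hmem y hy).1 h)⟩, Or.inl ?_⟩
    exact ball_subset_ball (by linarith) hx
  have hdisj : Disjoint (gained E (t • e) z r) (lost E (t • e) z r) := by
    rw [Set.disjoint_left]
    rintro x ⟨_, h1⟩ ⟨_, h2⟩
    exact h1.2 h2.1
  have h1 := (kMeasure_prod_ge hs hlam hK (measurableSet_gained hE (t • e) z r)
    (measurableSet_lost hE (t • e) z r) hdisj inter_subset_left inter_subset_left).trans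
    ((measure_mono hsub).trans (hb t ht.1.1))
  have hP0 : 0 ≤ (kPerimeter K (ball z (3 * R)) E).toReal := ENNReal.toReal_nonneg
  have hgf : volume (gained E (t • e) z r) ≠ ⊤ :=
    measure_ne_top_of_subset inter_subset_left (volume_ball_ne_top z r)
  have hlf : volume (lost E (t • e) z r) ≠ ⊤ :=
    measure_ne_top_of_subset inter_subset_left (volume_ball_ne_top z r)
  have hc0 : 0 ≤ lam / (2 * r) ^ (2 + s) := by positivity
  rw [← ofReal_measureReal hgf, ← ofReal_measureReal hlf, ← ENNReal.ofReal_mul hc0,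
    ← ENNReal.ofReal_mul (by positivity), ENNReal.ofReal_le_ofReal_iff (by positivity)] at h1
  generalize volume.real (gained E (t • e) z r) = g at h1 ⊢
  generalize volume.real (lost E (t • e) z r) = m at h1 ⊢
  generalize (kPerimeter K (ball z (3 * R)) E).toReal = p at h1 hP0 ⊢
  have hpow : (2 * r) ^ (2 + s) = 2 ^ (2 + s) * r ^ (2 + s) :=
    Real.mul_rpow (by norm_num) hr.le
  have h2pos : (0 : ℝ) < 2 ^ (2 + s) := Real.rpow_pos_of_pos (by norm_num) _
  have hrpos : (0 : ℝ) < r ^ (2 + s) := Real.rpow_pos_of_pos hr _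
  rw [hpow] at h1
  generalize (2 : ℝ) ^ (2 + s) = d at h1 h2pos ⊢
  generalize r ^ (2 + s) = q at h1 hrpos ⊢
  have h2 : g * m ≤ d * q / lam * ((146 * (Lam / lam) * (l / R) ^ 2 * p + η) * t ^ 2) := by
    calc g * m = d * q / lam * (lam / (d * q) * m * g) := by field_simp
      _ ≤ _ := by gcongr
  refine h2.trans ?_
  have h3 : 146 * (Lam / lam) * (l / R) ^ 2 * p + η
      ≤ (146 * (Lam / lam) * l ^ 2 + 1) * (p / R ^ 2 + η) := by
    have : 146 * (Lam / lam) * (l / R) ^ 2 * p = 146 * (Lam / lam) * l ^ 2 * (p / R ^ 2) := by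
      field_simp
    have hA : 0 ≤ 146 * (Lam / lam) * (l : ℝ) ^ 2 := by positivity
    have hB : 0 ≤ p / R ^ 2 := by positivity
    rw [this]
    nlinarith [mul_nonneg hA hη.le]
  calc d * q / lam * ((146 * (Lam / lam) * (l / R) ^ 2 * p + η) * t ^ 2)
      ≤ d * q / lam * ((146 * (Lam / lam) * l ^ 2 + 1) * (p / R ^ 2 + η) * t ^ 2) := by gcongr
    _ = _ := by ring

end SecondVariation

/-! ### Growth of the perimeter of a stable set -/

section EnergyBound

variable {s lam Lam : ℝ} {K : Plane → ℝ}

/-- Stability controls only translations shorter than an unspecified `t₀`; a given `h` is cut into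
`m` equal steps below that threshold. -/
lemma exists_small_step {h : Plane} (h0 : h ≠ 0) {t₀ : ℝ} (ht₀ : 0 < t₀) :
    ∃ (m : ℕ) (t : ℝ), (0 : ℝ) < m ∧ 0 < t ∧ |t| < t₀ ∧ m * t = ‖h‖ ∧
      (m : ℝ) • (t • (‖h‖⁻¹ • h)) = h ∧ m * ‖t • (‖h‖⁻¹ • h)‖ = ‖h‖ := by
  have hn : 0 < ‖h‖ := norm_pos_iff.2 h0
  obtain ⟨m, hm⟩ := exists_nat_gt (‖h‖ / t₀)
  have hm0 : (0 : ℝ) < m := (by positivity : 0 ≤ ‖h‖ / t₀).trans_lt hm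
  have ht : |‖h‖ / m| < t₀ := by
    rw [abs_of_pos (by positivity), div_lt_iff₀ hm0, mul_comm]
    exact (div_lt_iff₀ ht₀).1 hm
  refine ⟨m, ‖h‖ / m, hm0, by positivity, ht, by field_simp, ?_, ?_⟩
  · rw [smul_smul, smul_smul, show (m : ℝ) * (‖h‖ / m) * ‖h‖⁻¹ = 1 by field_simp, one_smul]
  · rw [norm_smul, norm_smul, norm_inv, norm_norm, inv_mul_cancel₀ hn.ne', mul_one,
      Real.norm_of_nonneg (by positivity)]
    field_simp

/-- A bound linear in `|t|` survives the addition of `m` steps of length `‖h‖ / m`, so the threshold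
`t₀` leaves no trace. The larger radius holds the intermediate translates. -/
lemma gained_add_lost_le_of_steps {E : Set Plane} {h z : Plane} {r d V : ℝ}
    (hd : ‖h‖ ≤ d)
    (hV : ∀ e : Plane, ‖e‖ = 1 → ∃ t₀ : ℝ, 0 < t₀ ∧ ∀ t, |t| < t₀ →
      volume.real (gained E (t • e) z (r + d)) + volume.real (lost E (t • e) z (r + d))
        ≤ V * |t|) :
    volume.real (gained E h z r) + volume.real (lost E h z r) ≤ V * ‖h‖ := by
  rcases eq_or_ne h 0 with rfl | h0
  · have h1 : gained E 0 z r = ∅ := by ext; simp [gained]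
    have h2 : lost E 0 z r = ∅ := by ext; simp [lost]
    simp [h1, h2]
  have hn : 0 < ‖h‖ := norm_pos_iff.2 h0
  obtain ⟨t₀, ht₀, hb⟩ := hV (‖h‖⁻¹ • h) (by
    rw [norm_smul, norm_inv, norm_norm, inv_mul_cancel₀ hn.ne'])
  obtain ⟨m, t, hm0, ht0, ht, hmt, hstep, hnorm⟩ := exists_small_step h0 ht₀
  have g1 := gained_nsmul_le (E := E) _ z (r := r) m (hnorm.trans_le hd)
  have g2 := lost_nsmul_le (E := E) _ z (r := r) m (hnorm.trans_le hd)
  rw [hstep] at g1 g2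
  calc _ ≤ m * (V * |t|) := by
        have := mul_le_mul_of_nonneg_left (hb _ ht) hm0.le
        linarith
    _ = V * ‖h‖ := by
        rw [abs_of_pos ht0, ← hmt]
        ring

/-- This is `(a + b)² = (a - b)² + 4ab`, with `r w + r² ≤ (r + w)²` for `w = q p`. -/
lemma add_le_of_abs_sub_le_of_mul_le {a b A C T q r p : ℝ} (hA : 0 ≤ A) (hC : 0 ≤ C)
    (hT : 0 ≤ T) (hr : 0 ≤ r) (hq : 0 ≤ q) (hp : 0 ≤ p)
    (h1 : |a - b| ≤ A * r * T) (h2 : a * b ≤ C * (r * (q * p) + r ^ 2) * T ^ 2) :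
    a + b ≤ (A + 2 * (C + 1)) * (r + q * p) * T := by
  have hw : 0 ≤ q * p := mul_nonneg hq hp
  generalize q * p = w at hw h2 ⊢
  refine abs_le_of_sq_le_sq' ?_ (by positivity) |>.2
  have h3 : (a - b) ^ 2 ≤ (A * r * T) ^ 2 := sq_le_sq' (by linarith [(abs_le.1 h1).1])
    (abs_le.1 h1).2
  have h4 : (a + b) ^ 2 ≤ (A * r * T) ^ 2 + 4 * (C * (r * w + r ^ 2) * T ^ 2) := by nlinarith
  refine h4.trans ?_
  have h5 : r * w + r ^ 2 ≤ (r + w) ^ 2 := by nlinarith [mul_nonneg hr hw, sq_nonneg w]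
  have h6 : r ^ 2 ≤ (r + w) ^ 2 := by nlinarith [mul_nonneg hr hw, sq_nonneg w]
  have h7 : C ≤ (C + 1) ^ 2 := by nlinarith
  have h8 : A ^ 2 + 4 * (C + 1) ^ 2 ≤ (A + 2 * (C + 1)) ^ 2 := by nlinarith
  calc (A * r * T) ^ 2 + 4 * (C * (r * w + r ^ 2) * T ^ 2)
      = (A ^ 2 * r ^ 2 + 4 * (C * (r * w + r ^ 2))) * T ^ 2 := by ring
    _ ≤ (A ^ 2 * (r + w) ^ 2 + 4 * ((C + 1) ^ 2 * (r + w) ^ 2)) * T ^ 2 := by gcongr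
    _ = (A ^ 2 + 4 * (C + 1) ^ 2) * (r + w) ^ 2 * T ^ 2 := by ring
    _ ≤ (A + 2 * (C + 1)) ^ 2 * (r + w) ^ 2 * T ^ 2 := by gcongr
    _ = _ := by ring

/-- The perimeter type estimate: translates of a stable set. -/
lemma exists_gained_add_lost_le (hs : s ∈ Ioo (0 : ℝ) 1) (hlam : 0 < lam)
    (hK : IsL2Kernel 2 s lam Lam K) : ∃ C : ℝ, 0 < C ∧ ∀ {E : Set Plane}, MeasurableSet E →
    ∀ {z : Plane} {r : ℝ}, 0 < r → IsStableSet K (ball z (12 * r)) E → ∀ h, ‖h‖ ≤ r →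
      volume.real (gained E h z r) + volume.real (lost E h z r)
        ≤ C * (r + r ^ (s - 1) * (kPerimeter K (ball z (12 * r)) E).toReal) * ‖h‖ := by
  obtain ⟨C, hC, hmain⟩ := exists_gained_mul_lost_le hs hlam hK
  have hDA := discArea_nonneg
  refine ⟨6 * discArea + 2 * (8 * C + 1), by positivity, fun {E} hE {z r} hr hst h hh => ?_⟩
  refine gained_add_lost_le_of_steps hh fun e he => ?_
  have hst' : IsStableSet K (ball z (3 * (4 * r))) E := by
    rwa [show 3 * (4 * r) = 12 * r by ring]
  -- Radius `2r` leaves room for steps of total length `r`, and `η = r^(-s)` has the scaling of `P /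
  -- R²`.
  obtain ⟨t₀, ht₀, hb⟩ := hmain hE (z := z) (R := 4 * r) (r := 2 * r) (by positivity) (by linarith)
    hst' he (η := r ^ (-s)) (Real.rpow_pos_of_pos hr _)
  rw [show 3 * (4 * r) = 12 * r by ring] at hb
  refine ⟨min t₀ (2 * r), by positivity, fun t ht => ?_⟩
  rw [lt_min_iff] at ht
  have hn : ‖t • e‖ = |t| := by rw [norm_smul, he, mul_one, Real.norm_eq_abs]
  have h1 := abs_gained_sub_lost_le hE (h := t • e) (z := z) (r := 2 * r) (by positivity)
    (by rw [hn]; exact ht.2.le)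
  have h2 := hb t ht.1
  have hP0 : 0 ≤ (kPerimeter K (ball z (12 * r)) E).toReal := ENNReal.toReal_nonneg
  rw [← two_mul r]
  refine add_le_of_abs_sub_le_of_mul_le (by positivity) (by positivity) (abs_nonneg t) hr.le
    (Real.rpow_nonneg hr.le _) hP0 (h1.trans_eq (by rw [hn]; ring)) (h2.trans ?_)
  rw [sq_abs]
  refine mul_le_mul_of_nonneg_right ?_ (sq_nonneg t)
  generalize (kPerimeter K (ball z (12 * r)) E).toReal = p at hP0
  have e1 : (2 * r) ^ (2 + s) ≤ 8 * (r ^ 2 * r ^ s) := by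
    rw [Real.mul_rpow (by norm_num) hr.le]
    have h8 : (2 : ℝ) ^ (2 + s) ≤ 8 := by
      calc (2 : ℝ) ^ (2 + s) ≤ 2 ^ (3 : ℝ) :=
          Real.rpow_le_rpow_of_exponent_le (by norm_num) (by linarith [hs.2])
        _ = 8 := by norm_num
    have h9 : r ^ (2 + s) = r ^ 2 * r ^ s := by
      rw [Real.rpow_add hr]; norm_num
    rw [h9]
    gcongr
  have e2 : r ^ s * r ^ (-s) = 1 := by rw [← Real.rpow_add hr]; simp
  have e3 : r * r ^ (s - 1) = r ^ s := by
    rw [Real.rpow_sub_one hr.ne']; field_simp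
  have hrs := Real.rpow_nonneg hr.le s
  have hrs' := Real.rpow_nonneg hr.le (-s)
  calc C * (2 * r) ^ (2 + s) * (p / (4 * r) ^ 2 + r ^ (-s))
      ≤ C * (8 * (r ^ 2 * r ^ s)) * (p / (4 * r) ^ 2 + r ^ (-s)) := by gcongr
    _ = 8 * C * (r ^ s * p / 16 + r ^ 2 * (r ^ s * r ^ (-s))) := by field_simp; ring
    _ ≤ 8 * C * (r ^ s * p + r ^ 2) := by
        rw [e2]
        gcongr
        · have : 0 ≤ r ^ s * p := by positivity
          linarith
        · linarith
    _ = _ := by rw [← e3]; ring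

/-- The perimeter of a stable set in a ball is absorbed by the one in a larger ball. -/
lemma exists_kPerimeter_le_add (hs : s ∈ Ioo (0 : ℝ) 1) (hlam : 0 < lam)
    (hK : IsL2Kernel 2 s lam Lam K) {ε : ℝ} (hε : 0 < ε) :
    ∃ C : ℝ, 0 < C ∧ ∀ {E : Set Plane}, MeasurableSet E →
    ∀ {z : Plane} {r : ℝ}, 0 < r → IsStableSet K (ball z (12 * r)) E →
      (kPerimeter K (ball z r) E).toReal
        ≤ C * r ^ (2 - s) + ε * (kPerimeter K (ball z (12 * r)) E).toReal := by
  obtain ⟨C, hC, hmain⟩ := exists_gained_add_lost_le hs hlam hK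
  have hDA := discArea_nonneg
  have hL := hK.Lam_pos hlam
  have hs1 : 0 < 1 - s := by linarith [hs.2]
  have hs0 := hs.1
  -- The powers `r^(s-1)` and `r^(1-s)` cancel, so the larger perimeter has coefficient `A δ^(1-s)`,
  -- which is small for small `δ` because `s < 1`.
  set A := 4 * discArea * Lam * C / (1 - s) with hA
  have hA0 : 0 ≤ A := by positivity
  obtain ⟨δ, hδ, hδ1, hδA⟩ : ∃ δ : ℝ, 0 < δ ∧ δ ≤ 1 ∧ A * δ ^ (1 - s) ≤ ε := by
    refine ⟨min 1 ((ε / (A + 1)) ^ (1 - s)⁻¹), by positivity, min_le_left _ _, ?_⟩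
    calc A * (min 1 ((ε / (A + 1)) ^ (1 - s)⁻¹)) ^ (1 - s)
        ≤ A * ((ε / (A + 1)) ^ (1 - s)⁻¹) ^ (1 - s) := by
          gcongr
          exact min_le_right _ _
      _ = A * (ε / (A + 1)) := by
          rw [← Real.rpow_mul (by positivity), inv_mul_cancel₀ hs1.ne', Real.rpow_one]
      _ ≤ (A + 1) * (ε / (A + 1)) := by gcongr; linarith
      _ = ε := by field_simp
  refine ⟨4 * discArea * Lam * (discArea * δ ^ (-s) / s) + ε, by positivity, ?_⟩
  intro E hE z r hr hst
  have hP0 : 0 ≤ (kPerimeter K (ball z (12 * r)) E).toReal := ENNReal.toReal_nonneg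
  have hb := kPerimeter_ball_le_of_translation hs hlam hK hE hr hδ hδ1
    (V := C * (r + r ^ (s - 1) * (kPerimeter K (ball z (12 * r)) E).toReal))
    (by positivity) (hmain hE hr hst)
  refine (ENNReal.toReal_le_of_le_ofReal (by positivity) hb).trans ?_
  generalize (kPerimeter K (ball z (12 * r)) E).toReal = p at hP0
  have e1 : r ^ 2 * (δ * r) ^ (-s) = δ ^ (-s) * r ^ (2 - s) := by
    rw [Real.mul_rpow hδ.le hr.le, sub_eq_add_neg, Real.rpow_add hr]
    norm_num
    ring
  have e2 : (r + r ^ (s - 1) * p) * (δ * r) ^ (1 - s) = δ ^ (1 - s) * (r ^ (2 - s) + p) := by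
    have h1 : r * r ^ (1 - s) = r ^ (2 - s) := by
      rw [show 2 - s = 1 + (1 - s) by ring, Real.rpow_add hr 1, Real.rpow_one]
    have h2 : r ^ (s - 1) * r ^ (1 - s) = 1 := by rw [← Real.rpow_add hr]; simp
    rw [Real.mul_rpow hδ.le hr.le, ← h1]
    linear_combination (δ ^ (1 - s) * p) * h2
  have hrp : 0 ≤ r ^ (2 - s) := Real.rpow_nonneg hr.le _
  calc 4 * discArea * Lam * (discArea * r ^ 2 * (δ * r) ^ (-s) / s
        + C * (r + r ^ (s - 1) * p) * (δ * r) ^ (1 - s) / (1 - s))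
      = 4 * discArea * Lam * (discArea * (r ^ 2 * (δ * r) ^ (-s)) / s)
        + A / C * (C * ((r + r ^ (s - 1) * p) * (δ * r) ^ (1 - s))) := by
        rw [hA]; field_simp
    _ = 4 * discArea * Lam * (discArea * δ ^ (-s) / s) * r ^ (2 - s)
        + (A * δ ^ (1 - s)) * (r ^ (2 - s) + p) := by
        rw [e1, e2]; field_simp
    _ ≤ 4 * discArea * Lam * (discArea * δ ^ (-s) / s) * r ^ (2 - s)
        + ε * (r ^ (2 - s) + p) := by gcongr
    _ = _ := by ring

lemma IsStableSet.isFinite {Ω E : Set Plane} (h : IsStableSet K Ω E) : kPerimeter K Ω E ≠ ⊤ :=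
  h.1.ne

/-- The sharp growth of the perimeter of a set which is stable in every compact set. -/
lemma exists_kPerimeter_ball_le (hs : s ∈ Ioo (0 : ℝ) 1) (hlam : 0 < lam)
    (hK : IsL2Kernel 2 s lam Lam K) : ∃ C : ℝ, 0 < C ∧ ∀ {E : Set Plane}, MeasurableSet E →
    (∀ z r, IsStableSet K (ball z r) E) → ∀ {R : ℝ}, 0 < R →
      (kPerimeter K (ball 0 R) E).toReal ≤ C * R ^ (2 - s) := by
  -- Scaled by `r / 2`, the covering balls have radius `r / 48`, and enlarging them 12 times gives
  -- radius `r / 4`. Their centers stay at distance at least `r / 2` from the boundary of the big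
  -- ball, so the enlarged balls are admissible in the supremum below.
  obtain ⟨T, hTs, hTf, hTc⟩ := (isCompact_closedBall (0 : Plane) 1).finite_cover_balls
    (e := 1 / 24) (by norm_num)
  obtain ⟨N, hN⟩ : ∃ N : ℝ, N = hTf.toFinset.card := ⟨_, rfl⟩
  have hN0 : 0 ≤ N := hN ▸ Nat.cast_nonneg _
  obtain ⟨C, hC, hmain⟩ := exists_kPerimeter_le_add hs hlam hK
    (ε := 1 / (2 * (N + 1))) (by positivity)
  refine ⟨2 * (N + 1) * C * 2 ^ (2 - s), by positivity, fun {E} hE hst {R₀} hR₀ => ?_⟩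
  have hKm := hK.measurable hs hlam
  have hmono : ∀ {z w : Plane} {r q : ℝ}, ball z r ⊆ ball w q →
      (kPerimeter K (ball z r) E).toReal ≤ (kPerimeter K (ball w q) E).toReal := fun h =>
    ENNReal.toReal_mono (hst _ _).isFinite
      (kPerimeter_mono_domain hKm measurableSet_ball measurableSet_ball hE h)
  obtain ⟨R, hR⟩ : ∃ R, R = 2 * R₀ := ⟨_, rfl⟩
  have hRpos : 0 < R := by linarith
  -- The supremum runs over balls whose radius is half the distance to the boundary. It is finite
  -- because the perimeter in the big ball is; the choice of `ε` then makes it at most a multiple of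
  -- `R^(2-s)` plus half of itself. With `R = 2 R₀` the central ball has radius `R₀`.
  let f : ball (0 : Plane) R → ℝ := fun x =>
    (kPerimeter K (ball (x : Plane) ((R - ‖(x : Plane)‖) / 2)) E).toReal
  have hx0 : ∀ x : ball (0 : Plane) R, ‖(x : Plane)‖ < R := fun x => mem_ball_zero_iff.1 x.2
  have hbdd : BddAbove (range f) := by
    refine ⟨(kPerimeter K (ball 0 R) E).toReal, ?_⟩
    rintro _ ⟨x, rfl⟩
    refine hmono (ball_subset_ball' ?_)
    rw [dist_zero_right]
    linarith [hx0 x]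
  have hne : Nonempty (ball (0 : Plane) R) := ⟨⟨0, mem_ball_self hRpos⟩⟩
  set S := ⨆ x, f x with hS
  have hS0 : 0 ≤ S := le_trans ENNReal.toReal_nonneg (le_ciSup hbdd ⟨0, mem_ball_self hRpos⟩)
  have hstep : S ≤ (N + 1) * (C * R ^ (2 - s) + 1 / (2 * (N + 1)) * S) := by
    refine ciSup_le fun x => ?_
    obtain ⟨r, hr⟩ : ∃ r, r = R - ‖(x : Plane)‖ := ⟨_, rfl⟩
    have hrpos : 0 < r := by linarith [hx0 x]
    have hcov : ball (x : Plane) (r / 2)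
        ⊆ ⋃ u ∈ hTf.toFinset, ball ((x : Plane) + (r / 2) • u) (r / 48) := by
      intro y hy
      have h1 : (2 / r) • (y - x) ∈ closedBall (0 : Plane) 1 := by
        rw [mem_closedBall_zero_iff, norm_smul, Real.norm_of_nonneg (by positivity)]
        rw [mem_ball_iff_norm] at hy
        calc 2 / r * ‖y - x‖ ≤ 2 / r * (r / 2) := by gcongr
          _ = 1 := by field_simp
      obtain ⟨u, hu, hyu⟩ := mem_iUnion₂.1 (hTc h1)
      refine mem_iUnion₂.2 ⟨u, hTf.mem_toFinset.2 hu, ?_⟩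
      rw [mem_ball_iff_norm] at hyu ⊢
      have h2 : y - (x + (r / 2) • u) = (r / 2) • ((2 / r) • (y - x) - u) := by
        rw [smul_sub, smul_smul, show r / 2 * (2 / r) = 1 by field_simp, one_smul]
        abel
      rw [h2, norm_smul, Real.norm_of_nonneg (by positivity)]
      calc r / 2 * ‖(2 / r) • (y - (x : Plane)) - u‖ < r / 2 * (1 / 24) := by gcongr
        _ = _ := by ring
    have hsum : f x ≤ ∑ u ∈ hTf.toFinset,
        (kPerimeter K (ball ((x : Plane) + (r / 2) • u) (r / 48)) E).toReal := by
      have h := kPerimeter_le_sum hKm hTf.toFinset measurableSet_ball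
        (fun u => measurableSet_ball) hE hcov
      rw [← ENNReal.toReal_sum fun u _ => (hst _ _).isFinite]
      change (kPerimeter K (ball (x : Plane) ((R - ‖(x : Plane)‖) / 2)) E).toReal ≤ _
      rw [← hr]
      exact ENNReal.toReal_mono (ENNReal.sum_ne_top.2 fun u _ => (hst _ _).isFinite) h
    have hterm : ∀ u ∈ hTf.toFinset,
        (kPerimeter K (ball ((x : Plane) + (r / 2) • u) (r / 48)) E).toReal
          ≤ C * R ^ (2 - s) + 1 / (2 * (N + 1)) * S := by
      intro u hu
      have hu1 : ‖u‖ ≤ 1 := mem_closedBall_zero_iff.1 (hTs (hTf.mem_toFinset.1 hu))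
      have hy : ‖(x : Plane) + (r / 2) • u‖ ≤ ‖(x : Plane)‖ + r / 2 := by
        refine (norm_add_le _ _).trans ?_
        rw [norm_smul, Real.norm_of_nonneg (by positivity)]
        nlinarith
      refine (hmain hE (by positivity) (hst _ _)).trans ?_
      have hrR : r / 48 ≤ R := by linarith [norm_nonneg (x : Plane)]
      have hyR : (x : Plane) + (r / 2) • u ∈ ball (0 : Plane) R := by
        rw [mem_ball_zero_iff]; linarith
      gcongr
      · linarith [hs.2]
      · refine le_trans (hmono (ball_subset_ball ?_)) (le_ciSup hbdd ⟨_, hyR⟩)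
        change _ ≤ (R - ‖(x : Plane) + (r / 2) • u‖) / 2
        linarith
    refine hsum.trans ((Finset.sum_le_card_nsmul _ _ _ hterm).trans ?_)
    rw [nsmul_eq_mul, ← hN]
    have hRs := Real.rpow_nonneg hRpos.le (2 - s)
    gcongr
    linarith
  have hhalf : (N + 1) * (C * R ^ (2 - s) + 1 / (2 * (N + 1)) * S)
      = (N + 1) * C * R ^ (2 - s) + S / 2 := by
    have : N + 1 ≠ 0 := by positivity
    field_simp
  rw [hhalf] at hstep
  have hfin : (kPerimeter K (ball 0 R₀) E).toReal ≤ S := by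
    refine le_trans (hmono (ball_subset_ball ?_)) (le_ciSup hbdd ⟨0, mem_ball_self hRpos⟩)
    change R₀ ≤ (R - ‖(0 : Plane)‖) / 2
    rw [norm_zero]
    linarith
  have hRs : R ^ (2 - s) = 2 ^ (2 - s) * R₀ ^ (2 - s) := by
    rw [hR, Real.mul_rpow (by norm_num) hR₀.le]
  rw [hRs] at hstep
  linarith

end EnergyBound

/-! ### Total ordering of the translates -/

section Monotonicity

variable {s lam Lam : ℝ} {K : Plane → ℝ}

/-- With `r` fixed and `R → ∞`, the growth bound gives `P_{3R} / R² ≤ B R^(-s) → 0`: the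
subquadratic growth beats the squared gradient of the cutoff. -/
lemma exists_gained_mul_lost_le_small (hs : s ∈ Ioo (0 : ℝ) 1) (hlam : 0 < lam)
    (hK : IsL2Kernel 2 s lam Lam K) {E : Set Plane} (hE : MeasurableSet E)
    (hst : ∀ z r, IsStableSet K (ball z r) E) {r : ℝ} (hr : 0 < r) {e : Plane} (he : ‖e‖ = 1)
    {η : ℝ} (hη : 0 < η) : ∃ t₀ : ℝ, 0 < t₀ ∧ ∀ t, |t| < t₀ →
      volume.real (gained E (t • e) 0 r) * volume.real (lost E (t • e) 0 r) ≤ η * t ^ 2 := by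
  obtain ⟨C, hC, hmain⟩ := exists_gained_mul_lost_le hs hlam hK
  obtain ⟨C', hC', hP⟩ := exists_kPerimeter_ball_le hs hlam hK
  set A := C * r ^ (2 + s) with hA
  have hA0 : 0 < A := by positivity
  set B := C' * 3 ^ (2 - s) with hB
  have hlim : Filter.Tendsto (fun R : ℝ => B * R ^ (-s)) Filter.atTop (nhds (B * 0)) :=
    (tendsto_rpow_neg_atTop hs.1).const_mul B
  rw [mul_zero] at hlim
  obtain ⟨R, hRs, hR⟩ := ((hlim.eventually_lt_const (show 0 < η / (2 * A) by positivity)).and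
    (Filter.eventually_ge_atTop (2 * r))).exists
  have hR0 : 0 < R := by linarith
  obtain ⟨t₀, ht₀, hb⟩ := hmain hE hr hR (hst 0 (3 * R)) he (η := η / (2 * A)) (by positivity)
  refine ⟨t₀, ht₀, fun t ht => (hb t ht).trans (mul_le_mul_of_nonneg_right ?_ (sq_nonneg t))⟩
  have hq : (kPerimeter K (ball 0 (3 * R)) E).toReal / R ^ 2 ≤ B * R ^ (-s) := by
    rw [div_le_iff₀ (by positivity)]
    refine (hP hE hst (by positivity)).trans_eq ?_
    have : R ^ (2 - s) = R ^ (-s) * R ^ 2 := by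
      rw [show 2 - s = -s + 2 by ring, Real.rpow_add hR0]
      norm_num
    rw [Real.mul_rpow (by norm_num) hR0.le, this, hB]
    ring
  calc A * ((kPerimeter K (ball 0 (3 * R)) E).toReal / R ^ 2 + η / (2 * A))
      ≤ A * (η / (2 * A) + η / (2 * A)) :=
        mul_le_mul_of_nonneg_left (by linarith) hA0.le
    _ = η := by field_simp; ring

/-- Locally, a translation of a stable set does not both gain and lose. -/
lemma gained_eq_zero_or_lost_eq_zero (hs : s ∈ Ioo (0 : ℝ) 1) (hlam : 0 < lam)
    (hK : IsL2Kernel 2 s lam Lam K) {E : Set Plane} (hE : MeasurableSet E)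
    (hst : ∀ z r, IsStableSet K (ball z r) E) {r : ℝ} (hr : 0 < r) (h : Plane) :
    volume.real (gained E h 0 r) = 0 ∨ volume.real (lost E h 0 r) = 0 := by
  rcases eq_or_ne h 0 with rfl | h0
  · left
    have : gained E 0 0 r = ∅ := by ext; simp [gained]
    simp [this]
  by_contra hcon
  push Not at hcon
  have hn : 0 < ‖h‖ := norm_pos_iff.2 h0
  have hG : 0 < volume.real (gained E h 0 r) := lt_of_le_of_ne measureReal_nonneg hcon.1.symm
  have hL : 0 < volume.real (lost E h 0 r) := lt_of_le_of_ne measureReal_nonneg hcon.2.symm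
  obtain ⟨t₀, ht₀, hb⟩ := exists_gained_mul_lost_le_small hs hlam hK hE hst
    (r := r + ‖h‖) (by positivity) (e := ‖h‖⁻¹ • h)
    (by rw [norm_smul, norm_inv, norm_norm, inv_mul_cancel₀ hn.ne'])
    -- Over `m` steps the product grows by at most `m²`, and `m t = ‖h‖`; this `η` makes the
    -- positive product at most half of itself.
    (η := volume.real (gained E h 0 r) * volume.real (lost E h 0 r) / (2 * ‖h‖ ^ 2))
    (by positivity)
  obtain ⟨m, t, hm0, ht0, ht, hmt, hstep, hnorm⟩ := exists_small_step h0 ht₀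
  have g1 := gained_nsmul_le (E := E) _ 0 (r := r) m hnorm.le
  have g2 := lost_nsmul_le (E := E) _ 0 (r := r) m hnorm.le
  rw [hstep] at g1 g2
  have hb' := hb _ ht
  have hg := mul_le_mul g1 g2 measureReal_nonneg (by positivity)
  have hprod : 0 < volume.real (gained E h 0 r) * volume.real (lost E h 0 r) := mul_pos hG hL
  generalize volume.real (gained E h 0 r) * volume.real (lost E h 0 r) = q at *
  have : q ≤ q / 2 := by
    calc q ≤ _ := hg
      _ = (m : ℝ) ^ 2 * (volume.real (gained E (t • (‖h‖⁻¹ • h)) 0 (r + ‖h‖))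
          * volume.real (lost E (t • (‖h‖⁻¹ • h)) 0 (r + ‖h‖))) := by ring
      _ ≤ (m : ℝ) ^ 2 * (q / (2 * ‖h‖ ^ 2) * t ^ 2) := by gcongr
      _ = q / 2 := by rw [← hmt]; field_simp
  linarith

/-- The translates of a set which is stable in every compact set are totally ordered. -/
lemma translate_ae_le_or_ge (hs : s ∈ Ioo (0 : ℝ) 1) (hlam : 0 < lam)
    (hK : IsL2Kernel 2 s lam Lam K) {E : Set Plane} (hE : MeasurableSet E)
    (hst : ∀ z r, IsStableSet K (ball z r) E) (h : Plane) :
    volume {x | x - h ∈ E ∧ x ∉ E} = 0 ∨ volume {x | x ∈ E ∧ x - h ∉ E} = 0 := by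
  have hmono : ∀ (S : Set Plane) {r q : ℝ}, r ≤ q → volume.real (ball 0 q ∩ S) = 0 →
      volume.real (ball 0 r ∩ S) = 0 := by
    intro S r q hrq h0
    refine le_antisymm (h0 ▸ measureReal_mono ?_ ?_) measureReal_nonneg
    · exact inter_subset_inter_left _ (ball_subset_ball hrq)
    · exact measure_ne_top_of_subset inter_subset_left (volume_ball_ne_top 0 q)
  have hglob : ∀ S : Set Plane, (∀ n : ℕ, volume.real (ball 0 ((n : ℝ) + 1) ∩ S) = 0) →
      volume S = 0 := by
    intro S hS
    have hU : S ⊆ ⋃ n : ℕ, ball (0 : Plane) ((n : ℝ) + 1) ∩ S := by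
      intro x hx
      obtain ⟨n, hn⟩ := exists_nat_gt ‖x‖
      exact mem_iUnion.2 ⟨n, mem_ball_zero_iff.2 (by linarith), hx⟩
    refine measure_mono_null hU (measure_iUnion_null fun n => ?_)
    have hf : volume (ball (0 : Plane) ((n : ℝ) + 1) ∩ S) ≠ ⊤ :=
      measure_ne_top_of_subset inter_subset_left (volume_ball_ne_top 0 _)
    exact (measureReal_eq_zero_iff hf).1 (hS n)
  by_cases hall : ∀ n : ℕ, volume.real (gained E h 0 ((n : ℝ) + 1)) = 0
  · exact Or.inl (hglob _ hall)
  · right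
    push Not at hall
    obtain ⟨n, hn⟩ := hall
    refine hglob _ fun k => ?_
    -- In a ball containing both radii the gain is positive, hence the loss vanishes there.
    have hk := gained_eq_zero_or_lost_eq_zero hs hlam hK hE hst
      (r := max ((n : ℝ) + 1) ((k : ℝ) + 1)) (by positivity) h
    rcases hk with hk | hk
    · exact absurd (hmono _ (le_max_left _ _) hk) hn
    · exact hmono _ (le_max_right _ _) hk

end Monotonicity

/-! ### Sets ordered with all their translates -/

section Classification

/-- The directions along which the measure of `E` in closed balls does not decrease. -/
def increasingDirections (E : Set Plane) : Set Plane :=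
  {h | ∀ x r, 0 ≤ r → volume.real (E ∩ closedBall x r) ≤ volume.real (E ∩ closedBall (x + h) r)}

variable {E : Set Plane}

lemma volume_real_closedBall {r : ℝ} (hr : 0 ≤ r) (z : Plane) :
    volume.real (closedBall z r) = r ^ 2 * discArea := by
  rw [← volume_real_ball hr z, Measure.real, Measure.real, Measure.addHaar_closedBall_eq_addHaar_ball]

lemma volume_closedBall_ne_top (z : Plane) (r : ℝ) : volume (closedBall z r) ≠ ⊤ :=
  measure_closedBall_lt_top.ne

lemma volume_real_inter_closedBall_le {x y : Plane} {r : ℝ} (hr : 0 ≤ r) :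
    volume.real (E ∩ closedBall x r)
      ≤ volume.real (E ∩ closedBall y r) + discArea * ((r + dist x y) ^ 2 - r ^ 2) := by
  have hsub : E ∩ closedBall x r
      ⊆ (E ∩ closedBall y r) ∪ (closedBall y (r + dist x y) \ closedBall y r) := by
    rintro p ⟨hpE, hp⟩
    by_cases h : p ∈ closedBall y r
    · exact Or.inl ⟨hpE, h⟩
    · refine Or.inr ⟨?_, h⟩
      rw [mem_closedBall] at hp ⊢
      linarith [dist_triangle p x y]
  have hf : volume ((E ∩ closedBall y r) ∪ (closedBall y (r + dist x y) \ closedBall y r)) ≠ ⊤ :=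
    measure_union_ne_top
      (measure_ne_top_of_subset inter_subset_right (volume_closedBall_ne_top _ _))
      (measure_ne_top_of_subset sdiff_subset (volume_closedBall_ne_top _ _))
  refine (measureReal_mono hsub hf).trans ((measureReal_union_le _ _).trans (le_of_eq ?_))
  rw [measureReal_sdiff (closedBall_subset_closedBall (by linarith [dist_nonneg (x := x) (y := y)]))
    measurableSet_closedBall (volume_closedBall_ne_top _ _),
    volume_real_closedBall (by positivity), volume_real_closedBall hr]
  ring

lemma continuous_volume_real_inter_closedBall {r : ℝ} (hr : 0 ≤ r) :
    Continuous fun x => volume.real (E ∩ closedBall x r) := by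
  rw [continuous_iff_continuousAt]
  intro x
  rw [ContinuousAt, tendsto_iff_dist_tendsto_zero]
  refine squeeze_zero (g := fun y => discArea * ((r + dist y x) ^ 2 - r ^ 2))
    (fun _ => dist_nonneg) (fun y => ?_) ?_
  · rw [Real.dist_eq, abs_sub_le_iff]
    have h1 := volume_real_inter_closedBall_le (E := E) (x := y) (y := x) hr
    have h2 := volume_real_inter_closedBall_le (E := E) (x := x) (y := y) hr
    rw [dist_comm x y] at h2
    constructor <;> linarith
  · have hc : Continuous fun y => discArea * ((r + dist y x) ^ 2 - r ^ 2) := by fun_prop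
    simpa using hc.tendsto x

/-- The measure of `E` in a closed ball depends continuously on the center. Testing on balls thus
turns almost-everywhere monotonicity into a closed condition. -/
lemma isClosed_increasingDirections : IsClosed (increasingDirections E) := by
  have : increasingDirections E = ⋂ (x : Plane) (r : ℝ) (_ : 0 ≤ r),
      {h | volume.real (E ∩ closedBall x r) ≤ volume.real (E ∩ closedBall (x + h) r)} := by
    ext h
    simp [increasingDirections]
  rw [this]
  refine isClosed_iInter fun x => isClosed_iInter fun r => isClosed_iInter fun hr => ?_
  exact isClosed_le continuous_const
    ((continuous_volume_real_inter_closedBall hr).comp (continuous_const.add continuous_id))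

lemma add_mem_increasingDirections {h k : Plane} (hh : h ∈ increasingDirections E)
    (hk : k ∈ increasingDirections E) : h + k ∈ increasingDirections E := by
  intro x r hr
  have := (hh x r hr).trans (hk (x + h) r hr)
  rwa [add_assoc] at this

lemma zero_mem_increasingDirections : (0 : Plane) ∈ increasingDirections E := by
  intro x r _
  rw [add_zero]

lemma nsmul_mem_increasingDirections {h : Plane} (hh : h ∈ increasingDirections E) (n : ℕ) :
    n • h ∈ increasingDirections E := by
  induction n with
  | zero => simpa using zero_mem_increasingDirections
  | succ n ih =>
    rw [succ_nsmul]
    exact add_mem_increasingDirections ih hh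

lemma mem_increasingDirections_of_volume_eq_zero {h : Plane}
    (h0 : volume {x | x - h ∈ E ∧ x ∉ E} = 0) : h ∈ increasingDirections E := by
  intro x r hr
  rw [← volume_real_translate h (E ∩ closedBall x r)]
  have hae : ({y | y - h ∈ E ∩ closedBall x r} : Set Plane)
      ≤ᵐ[volume] (E ∩ closedBall (x + h) r : Set Plane) := by
    rw [ae_le_set]
    refine measure_mono_null ?_ h0
    rintro y ⟨⟨hy1, hy2⟩, hy3⟩
    refine ⟨hy1, fun hyE => hy3 ⟨hyE, ?_⟩⟩
    rw [mem_closedBall_iff_norm] at hy2 ⊢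
    rwa [show y - (x + h) = y - h - x by abel]
  exact ENNReal.toReal_mono
    (measure_ne_top_of_subset inter_subset_right (volume_closedBall_ne_top _ _))
    (measure_mono_ae hae)

lemma neg_mem_increasingDirections_of_volume_eq_zero {h : Plane}
    (h0 : volume {x | x ∈ E ∧ x - h ∉ E} = 0) : -h ∈ increasingDirections E := by
  refine mem_increasingDirections_of_volume_eq_zero ?_
  rw [← volume_translate h]
  refine measure_mono_null ?_ h0
  rintro x ⟨h1, h2⟩
  rw [sub_neg_eq_add, sub_add_cancel] at h1
  exact ⟨h1, h2⟩

lemma smul_mem_increasingDirections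
    (htot : ∀ h, h ∈ increasingDirections E ∨ -h ∈ increasingDirections E)
    {h : Plane} (hh : h ∈ increasingDirections E) {t : ℝ}
    (ht : 0 ≤ t) : t • h ∈ increasingDirections E := by
  have hdiv : ∀ n : ℕ, ((n : ℝ) + 1)⁻¹ • h ∈ increasingDirections E := by
    intro n
    rcases htot (((n : ℝ) + 1)⁻¹ • h) with h1 | h1
    · exact h1
    -- If `-h / (n + 1)` is increasing, adding `n` copies of it to `h` gives `h / (n + 1)`. Other
    -- multiples follow by density and closedness.
    · have h2 := add_mem_increasingDirections hh (nsmul_mem_increasingDirections h1 n)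
      convert! h2 using 1
      rw [← Nat.cast_smul_eq_nsmul ℝ]
      match_scalars
      field_simp
      ring
  have hlim : Filter.Tendsto (fun n : ℕ => (((⌊t * ((n : ℝ) + 1)⌋₊ : ℝ)) / ((n : ℝ) + 1)) • h)
      Filter.atTop (nhds (t • h)) := by
    refine Filter.Tendsto.smul_const ?_ h
    exact (tendsto_nat_floor_mul_div_atTop ht).comp
      (Filter.tendsto_atTop_add_const_right _ 1 tendsto_natCast_atTop_atTop)
  refine isClosed_increasingDirections.mem_of_tendsto hlim (Filter.Eventually.of_forall fun n => ?_)
  have := nsmul_mem_increasingDirections (hdiv n) ⌊t * ((n : ℝ) + 1)⌋₊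
  rwa [← Nat.cast_smul_eq_nsmul ℝ, smul_smul, ← div_eq_mul_inv] at this

/-- The increasing directions and their negatives are closed sets covering the unit circle, each
meeting it; as the circle is connected, they meet on it. -/
lemma exists_invariant_direction
    (htot : ∀ h, h ∈ increasingDirections E ∨ -h ∈ increasingDirections E) :
    ∃ w : Plane, ‖w‖ = 1 ∧ w ∈ increasingDirections E ∧
    -w ∈ increasingDirections E := by
  have hrank : 1 < Module.rank ℝ Plane := by
    rw [← Module.finrank_eq_rank, finrank_plane]
    norm_num
  have hconn := isPreconnected_sphere hrank (0 : Plane) 1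
  rw [isPreconnected_closed_iff] at hconn
  obtain ⟨v, hv⟩ := (NormedSpace.sphere_nonempty (x := (0 : Plane)) (r := 1)).2 zero_le_one
  have hv' : -v ∈ sphere (0 : Plane) 1 := by simpa using hv
  have hne : (sphere (0 : Plane) 1 ∩ increasingDirections E).Nonempty ∧
      (sphere (0 : Plane) 1 ∩ {h | -h ∈ increasingDirections E}).Nonempty := by
    rcases htot v with h | h
    · exact ⟨⟨v, hv, h⟩, ⟨-v, hv', by simpa using h⟩⟩
    · exact ⟨⟨-v, hv', h⟩, ⟨v, hv, h⟩⟩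
  obtain ⟨w, hw, h1, h2⟩ := hconn (increasingDirections E) {h | -h ∈ increasingDirections E}
    isClosed_increasingDirections (isClosed_increasingDirections.preimage continuous_neg)
    (fun h _ => htot h) hne.1 hne.2
  exact ⟨w, by simpa using hw, h1, h2⟩

/-- The increasing directions contain the line of an invariant direction `w` and, by totality, a ray
orthogonal to `w`; sums of the two fill a half-plane. -/
lemma exists_halfSpace_directions
    (htot : ∀ h, h ∈ increasingDirections E ∨ -h ∈ increasingDirections E) :
    ∃ ν : Plane, ‖ν‖ = 1 ∧
    ∀ h, inner ℝ ν h ≤ 0 → h ∈ increasingDirections E := by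
  obtain ⟨w, hw, hw1, hw2⟩ := exists_invariant_direction htot
  have hsq : w 0 ^ 2 + w 1 ^ 2 = 1 := by
    have := EuclideanSpace.real_norm_sq_eq w
    rw [hw, Fin.sum_univ_two] at this
    linarith
  have hline : ∀ t : ℝ, t • w ∈ increasingDirections E := by
    intro t
    rcases le_total 0 t with ht | ht
    · exact smul_mem_increasingDirections htot hw1 ht
    · have := smul_mem_increasingDirections htot hw2 (neg_nonneg.2 ht)
      rwa [smul_neg, neg_smul, neg_neg] at this
  have key : ∀ ν : Plane, (∀ h : Plane, h = (inner ℝ w h) • w + (inner ℝ ν h) • ν) →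
      -ν ∈ increasingDirections E → ∀ h, inner ℝ ν h ≤ 0 → h ∈ increasingDirections E := by
    intro ν hdec hν h hh
    rw [hdec h]
    refine add_mem_increasingDirections (hline _) ?_
    have := smul_mem_increasingDirections htot hν (neg_nonneg.2 hh)
    rwa [smul_neg, neg_smul, neg_neg] at this
  set ν : Plane := !₂[-w 1, w 0] with hν
  have hν0 : ν 0 = -w 1 := rfl
  have hν1 : ν 1 = w 0 := rfl
  have hn : ‖ν‖ = 1 := by
    have := EuclideanSpace.real_norm_sq_eq ν
    rw [Fin.sum_univ_two, hν0, hν1, neg_sq, add_comm, hsq] at this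
    exact (pow_eq_one_iff_of_nonneg (norm_nonneg ν) two_ne_zero).1 this
  have hdec : ∀ h : Plane, h = (inner ℝ w h) • w + (inner ℝ ν h) • ν := by
    intro h
    ext i
    fin_cases i
    · simp [PiLp.inner_apply, hν0, hν1]
      linear_combination (-h 0) * hsq
    · simp [PiLp.inner_apply, hν0, hν1]
      linear_combination (-h 1) * hsq
  rcases htot ν with h | h
  · refine ⟨-ν, by rwa [norm_neg], key (-ν) (fun h => ?_) (by rwa [neg_neg])⟩
    conv_lhs => rw [hdec h]
    simp
  · exact ⟨ν, hn, key ν hdec h⟩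

lemma volume_level_eq_zero {ν : Plane} (hν : ‖ν‖ = 1) (c : ℝ) :
    volume {x : Plane | inner ℝ ν x = c} = 0 := by
  have h1 : {x : Plane | inner ℝ ν x = c}
      = {x | x - c • ν ∈ ((LinearMap.ker (innerSL ℝ ν).toLinearMap : Submodule ℝ Plane) :
        Set Plane)} := by
    ext x
    simp [inner_sub_right, inner_smul_right, hν, sub_eq_zero]
  rw [h1, volume_translate]
  refine Measure.addHaar_submodule volume _ fun htop => ?_
  have h2 : ν ∈ (LinearMap.ker (innerSL ℝ ν).toLinearMap : Submodule ℝ Plane) := by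
    rw [htop]; trivial
  simp at h2
  rw [h2] at hν
  simp at hν

/-- The density points of `E`. -/
def densityPoints (E : Set Plane) : Set Plane :=
  {x | Filter.Tendsto (fun r => volume.real (E ∩ closedBall x r) / volume.real (closedBall x r))
    (nhdsWithin 0 (Ioi 0)) (nhds 1)}

lemma densityPoints_ae_eq (hE : MeasurableSet E) : densityPoints E =ᵐ[volume] E := by
  have h := Besicovitch.ae_tendsto_measure_inter_div_of_measurableSet
    (volume : Measure Plane) hE
  refine Filter.eventuallyEq_set.2 ?_
  filter_upwards [h] with x hx
  have hx' : Filter.Tendsto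
      (fun r => volume.real (E ∩ closedBall x r) / volume.real (closedBall x r))
      (nhdsWithin 0 (Ioi 0)) (nhds (E.indicator (1 : Plane → ENNReal) x).toReal) := by
    have hne : E.indicator (1 : Plane → ENNReal) x ≠ ⊤ := by
      by_cases hxE : x ∈ E <;> simp [hxE]
    have h2 := (ENNReal.tendsto_toReal hne).comp hx
    refine h2.congr fun r => ?_
    simp [Measure.real, ENNReal.toReal_div]
  constructor
  · intro hd
    by_contra hxE
    rw [indicator_of_notMem hxE] at hx'
    have := tendsto_nhds_unique hd hx'
    simp at this
  · intro hxE
    rw [indicator_of_mem hxE] at hx'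
    simpa [densityPoints] using hx'

/-- The density ratio at `x + h` lies between the one at `x` and `1`. The density points are thus a
representative of `E` that is monotone at every point. -/
lemma add_mem_densityPoints {h x : Plane} (hh : h ∈ increasingDirections E)
    (hx : x ∈ densityPoints E) : x + h ∈ densityPoints E := by
  refine tendsto_of_tendsto_of_tendsto_of_le_of_le' hx tendsto_const_nhds ?_ ?_
  · filter_upwards [self_mem_nhdsWithin] with r hr
    have hr' : 0 ≤ r := (show 0 < r from hr).le
    rw [volume_real_closedBall hr', volume_real_closedBall hr']
    have := discArea_nonneg
    exact div_le_div_of_nonneg_right (hh x r hr') (by positivity)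
  · filter_upwards with r
    refine div_le_one_of_le₀ ?_ measureReal_nonneg
    exact measureReal_mono inter_subset_right (volume_closedBall_ne_top _ _)

/-- Membership in the density points passes to every point with a smaller value of `ν · x`. They
therefore form the empty set, the plane, or a half-plane up to part of its boundary line, which is
null. -/
lemma ae_eq_empty_or_univ_or_halfSpace
    (htot : ∀ h, h ∈ increasingDirections E ∨ -h ∈ increasingDirections E)
    (hE : MeasurableSet E) :
    E =ᵐ[volume] (∅ : Set Plane) ∨ E =ᵐ[volume] (univ : Set Plane) ∨
      ∃ H, IsHalfSpace H ∧ E =ᵐ[volume] H := by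
  obtain ⟨ν, hν, hdir⟩ := exists_halfSpace_directions htot
  have hlow : ∀ x ∈ densityPoints E, ∀ y, inner ℝ ν y ≤ inner ℝ ν x → y ∈ densityPoints E := by
    intro x hx y hy
    have := add_mem_densityPoints (hdir (y - x) (by rw [inner_sub_right]; linarith)) hx
    rwa [add_sub_cancel] at this
  have hae := densityPoints_ae_eq hE
  set T : Set ℝ := (fun x : Plane => inner ℝ ν x) '' densityPoints E with hT
  rcases (densityPoints E).eq_empty_or_nonempty with hemp | hne
  · left
    rw [hemp] at hae
    exact hae.symm
  right
  by_cases hb : BddAbove T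
  · right
    refine ⟨{x | inner ℝ ν x ≤ sSup T}, ⟨ν, hν, sSup T, rfl⟩, hae.symm.trans ?_⟩
    have hsub : densityPoints E ⊆ {x | inner ℝ ν x ≤ sSup T} := fun x hx =>
      le_csSup hb ⟨x, hx, rfl⟩
    rw [ae_eq_set]
    refine ⟨by rw [sdiff_eq_empty.2 hsub, measure_empty], ?_⟩
    refine measure_mono_null ?_ (volume_level_eq_zero hν (sSup T))
    rintro x ⟨hx1, hx2⟩
    refine le_antisymm hx1 ?_
    by_contra hlt
    obtain ⟨_, ⟨y, hy, rfl⟩, hyx⟩ := exists_lt_of_lt_csSup (hne.image _) (not_le.1 hlt)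
    exact hx2 (hlow y hy x hyx.le)
  · left
    have huniv : densityPoints E = univ := by
      refine eq_univ_of_forall fun x => ?_
      rw [not_bddAbove_iff] at hb
      obtain ⟨_, ⟨y, hy, rfl⟩, hyx⟩ := hb (inner ℝ ν x)
      exact hlow y hy x hyx.le
    rw [huniv] at hae
    exact hae.symm

end Classification

/-! ### Passage to measurable representatives and conclusion -/

lemma IsStableSet.congr {K : Plane → ℝ} {Ω E E' : Set Plane} (h : E =ᵐ[volume] E')
    (hst : IsStableSet K Ω E) : IsStableSet K Ω E' := by
  rw [IsStableSet, kPerimeter_congr h] at hst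
  refine ⟨hst.1, fun X hX Ψ hΨ ε hε => ?_⟩
  obtain ⟨t₀, ht₀, hb⟩ := hst.2 X hX Ψ hΨ ε hε
  refine ⟨t₀, ht₀, fun t ht => ?_⟩
  obtain ⟨C, hC⟩ := exists_flow_lipschitz hX hΨ t
  have hF := image_ae_eq_of_lipschitz hC h
  have := hb t ht
  rwa [kPerimeter_congr (hF.union h), kPerimeter_congr (hF.inter h)] at this

theorem mainTheorem6 (s lam Lam : ℝ) (hs : s ∈ Set.Ioo (0 : ℝ) 1) (hlam : 0 < lam)
    (K : EuclideanSpace ℝ (Fin 2) → ℝ) (hK : IsL2Kernel 2 s lam Lam K)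
    (E : Set (EuclideanSpace ℝ (Fin 2))) (hE : MeasureTheory.NullMeasurableSet E) :
    IsStableInEveryCompact K E ↔
      (E =ᵐ[MeasureTheory.volume] (∅ : Set (EuclideanSpace ℝ (Fin 2))) ∨
        E =ᵐ[MeasureTheory.volume] (Set.univ : Set (EuclideanSpace ℝ (Fin 2))) ∨
        ∃ H : Set (EuclideanSpace ℝ (Fin 2)), IsHalfSpace H ∧ E =ᵐ[MeasureTheory.volume] H) := by
  constructor
  · intro hst
    obtain ⟨E', hE'm, hE'⟩ : ∃ E' : Set Plane, MeasurableSet E' ∧ E =ᵐ[volume] E' :=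
      ⟨_, measurableSet_toMeasurable volume E, hE.toMeasurable_ae_eq.symm⟩
    have hst' : ∀ z r, IsStableSet K (ball z r) E' := fun z r =>
      (hst (ball z r) isOpen_ball isBounded_ball).congr hE'
    have htot : ∀ h, h ∈ increasingDirections E' ∨ -h ∈ increasingDirections E' := fun h =>
      (translate_ae_le_or_ge hs hlam hK hE'm hst' h).imp
        mem_increasingDirections_of_volume_eq_zero neg_mem_increasingDirections_of_volume_eq_zero
    rcases ae_eq_empty_or_univ_or_halfSpace htot hE'm with h | h | ⟨H, hH, h⟩
    · exact Or.inl (hE'.trans h)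
    · exact Or.inr (Or.inl (hE'.trans h))
    · exact Or.inr (Or.inr ⟨H, hH, hE'.trans h⟩)
  · rintro (h | h | ⟨H, hH, h⟩)
    · exact isStableInEveryCompact_of_kPerimeter_eq_zero fun Ω => by
        rw [kPerimeter_congr h, kPerimeter_empty]
    · exact isStableInEveryCompact_of_kPerimeter_eq_zero fun Ω => by
        rw [kPerimeter_congr h, kPerimeter_univ]
    · exact isStableInEveryCompact_of_halfSpace hs hlam hK hH h
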